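/- Let $N,k\ge 1$ be integers and $p\in(0,\infty)$. There are constants $c,C>0$, depending only on $N,k,p$, such that for every rearrangement invariant (r.i.) Banach function space $X$ on $\mathbb R^N$ (with Lebesgue measure, in the sense of Bennett–Sharpley: the function norm is monotone, has the Fatou property, is finite on indicators of sets of finite measure, controls the integral over each set of finite measure, and takes equal values at equimeasurable functions), every (real- or complex-valued) $f\in W^kX$ and every $t\in(0,\infty)$, $$c\left(\frac1{t^N}\int_{|h|\le t}\|\Delta_h^kf\|_X^p\,dh\right)^{1/p}\le K(t^k,f;X,\dot W^kX)\le C\left(\frac1{t^N}\int_{|h|\le t}\|\Delta_h^kf\|_X^p\,dh\right)^{1/p}.$$ Here $\dot W^kX$ is the set of all distributions $g$ on $\mathbb R^N$ with $\partial^\alpha g\in X$ for all multi-indices $|\alpha|=k$, with $\|g\|_{\dot W^kX}=\sum_{|\alpha|=k}\|\partial^\alpha g\|_X$; $W^kX$ is the set of all locally integrable functions $f$ with $\partial^\alpha f\in X$ for all $|\alpha|\le k$; $\Delta_h^kf(x)=\sum_{j=0}^k(-1)^{j+k}\binom kj f(x+jh)$; and $$K(s,f;X,\dot W^kX)=\inf\{\|f_0\|_X+s\|f_1\|_{\dot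 W^kX}: f=f_0+f_1,\ f_0\in X,\ f_1\in\dot W^kX\}.$$ -/

import Mathlib

open MeasureTheory TopologicalSpace
open scoped ENNReal NNReal Distributions LineDeriv

/-- A rearrangement invariant Banach function norm on `ℝ^N` with Lebesgue measure, in the sense of
Bennett and Sharpley. It is a functional on the nonnegative (extended valued) a.e.-measurable
functions; values on other functions are irrelevant. The corresponding r.i. space consists of the
measurable functions `f` for which the functional is finite at `|f|`, see `RISpace.Mem`. -/
structure RISpace (N : ℕ) where
  /-- the function norm -/
  fnorm : (EuclideanSpace ℝ (Fin N) → ℝ≥0∞) → ℝ≥0∞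
  fnorm_eq_zero_iff : ∀ f, AEMeasurable f volume → (fnorm f = 0 ↔ f =ᵐ[volume] 0)
  fnorm_smul : ∀ (a : ℝ≥0) (f), AEMeasurable f volume →
    fnorm (fun x => (a : ℝ≥0∞) * f x) = a * fnorm f
  fnorm_add_le : ∀ f g, AEMeasurable f volume → AEMeasurable g volume →
    fnorm (fun x => f x + g x) ≤ fnorm f + fnorm g
  fnorm_mono : ∀ f g, AEMeasurable f volume → AEMeasurable g volume →
    (∀ᵐ x ∂volume, g x ≤ f x) → fnorm g ≤ fnorm f
  /-- the Fatou property -/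
  fnorm_iSup : ∀ f : ℕ → EuclideanSpace ℝ (Fin N) → ℝ≥0∞, (∀ n, AEMeasurable (f n) volume) →
    (∀ᵐ x ∂volume, Monotone fun n => f n x) → fnorm (fun x => ⨆ n, f n x) = ⨆ n, fnorm (f n)
  fnorm_indicator_lt_top : ∀ s : Set (EuclideanSpace ℝ (Fin N)), MeasurableSet s →
    volume s < ∞ → fnorm (s.indicator fun _ => 1) < ∞
  lintegral_le_fnorm : ∀ s : Set (EuclideanSpace ℝ (Fin N)), MeasurableSet s → volume s < ∞ →
    ∃ C : ℝ≥0, ∀ f, AEMeasurable f volume → ∫⁻ x in s, f x ∂volume ≤ C * fnorm f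
  /-- equimeasurable functions have the same norm -/
  fnorm_rearrangement : ∀ f g, AEMeasurable f volume → AEMeasurable g volume →
    (∀ l : ℝ≥0∞, volume {x | l < f x} = volume {x | l < g x}) → fnorm f = fnorm g

noncomputable section

/-- The distribution `φ ↦ ∫ φ(x) f(x) dx` on `ℝ^N` given by a locally integrable function `f`
(by convention `0` if `f` is not locally integrable). -/
def regularDistribution {N : ℕ} {𝕜 : Type*} [RCLike 𝕜] (f : EuclideanSpace ℝ (Fin N) → 𝕜) :
    𝓓'((⊤ : Opens (EuclideanSpace ℝ (Fin N))), 𝕜) :=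
  ContinuousLinearMap.toUniformConvergenceCLM _ _ _
    (TestFunction.integralAgainstBilinCLM (ContinuousLinearMap.lsmul ℝ ℝ) volume f)

theorem regularDistribution_apply {N : ℕ} {𝕜 : Type*} [RCLike 𝕜]
    {f : EuclideanSpace ℝ (Fin N) → 𝕜} (hf : LocallyIntegrable f volume)
    (φ : 𝓓((⊤ : Opens (EuclideanSpace ℝ (Fin N))), ℝ)) :
    regularDistribution f φ = ∫ x, φ x • f x := by
  have h := TestFunction.integralAgainstBilinCLM_eq_integral (n := ⊤)
    (Ω := (⊤ : Opens (EuclideanSpace ℝ (Fin N))))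
    (B := (ContinuousLinearMap.lsmul ℝ ℝ : ℝ →L[ℝ] 𝕜 →L[ℝ] 𝕜)) (μ := volume) (φ := f)
    (hf.locallyIntegrableOn _) (f := φ)
  exact h

/-- The partial derivative `∂^α F` of a distribution `F` on `ℝ^N`, for a multi-index `α`. -/
def multiDeriv {N : ℕ} {𝕜 : Type*} [RCLike 𝕜] (α : Fin N → ℕ)
    (F : 𝓓'((⊤ : Opens (EuclideanSpace ℝ (Fin N))), 𝕜)) :
    𝓓'((⊤ : Opens (EuclideanSpace ℝ (Fin N))), 𝕜) :=
  (List.finRange N).foldr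
    (fun i G => (fun H : 𝓓'((⊤ : Opens (EuclideanSpace ℝ (Fin N))), 𝕜) =>
      ∂_{EuclideanSpace.single i (1 : ℝ)} H)^[α i] G) F

/-- The `k`-th order difference `Δ_h^k f`. -/
def iterDiff {N : ℕ} {𝕜 : Type*} [RCLike 𝕜] (k : ℕ) (h : EuclideanSpace ℝ (Fin N))
    (f : EuclideanSpace ℝ (Fin N) → 𝕜) (x : EuclideanSpace ℝ (Fin N)) : 𝕜 :=
  ∑ j ∈ Finset.range (k + 1), (-1 : 𝕜) ^ (j + k) * (k.choose j : 𝕜) * f (x + (j : ℝ) • h)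

namespace RISpace

variable {N : ℕ} {𝕜 : Type*} [RCLike 𝕜]

/-- `‖f‖_X`, with value `∞` allowed. -/
def norm (X : RISpace N) (f : EuclideanSpace ℝ (Fin N) → 𝕜) : ℝ≥0∞ :=
  X.fnorm fun x => ‖f x‖ₑ

/-- `f ∈ X`. -/
def Mem (X : RISpace N) (f : EuclideanSpace ℝ (Fin N) → 𝕜) : Prop :=
  AEStronglyMeasurable f volume ∧ X.norm f < ∞

theorem Mem.locallyIntegrable {X : RISpace N} {f : EuclideanSpace ℝ (Fin N) → 𝕜}
    (hf : X.Mem f) : LocallyIntegrable f volume := by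
  intro x
  refine ⟨Metric.ball x 1, Metric.ball_mem_nhds x one_pos, hf.1.restrict, ?_⟩
  obtain ⟨C, hC⟩ := X.lintegral_le_fnorm (Metric.ball x 1) measurableSet_ball measure_ball_lt_top
  exact (hC _ hf.1.enorm).trans_lt (ENNReal.mul_lt_top ENNReal.coe_lt_top hf.2)

/-- The distribution `F` belongs to `X`. -/
def MemDistribution (X : RISpace N)
    (F : 𝓓'((⊤ : Opens (EuclideanSpace ℝ (Fin N))), 𝕜)) : Prop :=
  ∃ g : EuclideanSpace ℝ (Fin N) → 𝕜, X.Mem g ∧ regularDistribution g = F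

/-- `‖F‖_X` for a distribution `F`: the norm of the (a.e. unique) function in `X` that
represents `F`, and `∞` if `F` does not belong to `X`. -/
def distNorm (X : RISpace N) (F : 𝓓'((⊤ : Opens (EuclideanSpace ℝ (Fin N))), 𝕜)) : ℝ≥0∞ :=
  ⨅ (g : EuclideanSpace ℝ (Fin N) → 𝕜) (_ : X.Mem g ∧ regularDistribution g = F), X.norm g

/-- `F ∈ Ẇ^k X`: all partial derivatives of `F` of order exactly `k` belong to `X`. -/
def MemHomSobolev (X : RISpace N) (k : ℕ)
    (F : 𝓓'((⊤ : Opens (EuclideanSpace ℝ (Fin N))), 𝕜)) : Prop :=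
  ∀ α : Fin N → ℕ, ∑ i, α i = k → X.MemDistribution (multiDeriv α F)

/-- `‖F‖_{Ẇ^k X} = ∑_{|α| = k} ‖∂^α F‖_X`. -/
def homSobolevNorm (X : RISpace N) (k : ℕ)
    (F : 𝓓'((⊤ : Opens (EuclideanSpace ℝ (Fin N))), 𝕜)) : ℝ≥0∞ :=
  ∑ α ∈ Finset.piAntidiag (Finset.univ : Finset (Fin N)) k, X.distNorm (multiDeriv α F)

/-- `f ∈ W^k X`: `f` is locally integrable and all its distributional derivatives of order at most
`k` (including `f` itself) belong to `X`. -/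
def MemSobolev (X : RISpace N) (k : ℕ) (f : EuclideanSpace ℝ (Fin N) → 𝕜) : Prop :=
  LocallyIntegrable f volume ∧
    ∀ α : Fin N → ℕ, ∑ i, α i ≤ k → X.MemDistribution (multiDeriv α (regularDistribution f))

/-- Peetre's functional `K(s, F; X, Ẇ^k X)`: the infimum of `‖f₀‖_X + s ‖F₁‖_{Ẇ^k X}` over all
decompositions `F = f₀ + F₁` with `f₀ ∈ X` and `F₁ ∈ Ẇ^k X`. -/
def kFunctional (X : RISpace N) (k : ℕ) (s : ℝ)
    (F : 𝓓'((⊤ : Opens (EuclideanSpace ℝ (Fin N))), 𝕜)) : ℝ≥0∞ :=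
  ⨅ (f₀ : EuclideanSpace ℝ (Fin N) → 𝕜)
    (F₁ : 𝓓'((⊤ : Opens (EuclideanSpace ℝ (Fin N))), 𝕜))
    (_ : X.Mem f₀ ∧ X.MemHomSobolev k F₁ ∧ F = regularDistribution f₀ + F₁),
    X.norm f₀ + ENNReal.ofReal s * X.homSobolevNorm k F₁

/-- `(t^{-N} ∫_{|h| ≤ t} ‖Δ_h^k f‖_X^p dh)^{1/p}`. -/
def avgModulus (X : RISpace N) (k : ℕ) (p t : ℝ)
    (f : EuclideanSpace ℝ (Fin N) → 𝕜) : ℝ≥0∞ :=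
  ((ENNReal.ofReal (t ^ N))⁻¹ *
    ∫⁻ h in Metric.closedBall (0 : EuclideanSpace ℝ (Fin N)) t,
      X.norm (iterDiff k h f) ^ p ∂volume) ^ (1 / p)

end RISpace

end

/-!
Write `ω h = ‖Δ_h^k f‖_X`. The theorem compares the `L^p` mean of `ω` over a ball of radius `t`,
for an arbitrary exponent `p > 0`, with Peetre's functional. Both inequalities go through the
supremum of `ω` over balls.

Only one integral inequality is needed in an r.i. space: the norm of a mean of a jointly measurable
family is at most the supremum of the norms (`RISpace.norm_integral_le`). It is obtained without
duality: by the strong law of large numbers, the mean is almost everywhere the limit of arithmetic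
means of independent samples, and the Fatou property passes to the limit. In particular
mollification is a contraction in `X`, so estimates may be proved for smooth functions and
transferred by the Fatou property.

For smooth `F`, a mixed difference is an iterated mean, along segments, of the corresponding mixed
derivative (`diffList_eq_aveList_dirDerivList`). With all steps equal to `h` this gives
`‖Δ_h^k f₁‖_X ≤ (N |h|)^k ‖f₁‖_{Ẇ^k X}` (`RISpace.norm_iterDiff_le_homSobolevNorm`), and hence the
lower bound for the `K`-functional. With `k = 1` it shows that translation is Lipschitz continuous
on `W^k X`, so `ω` is continuous, and mollifications of `f` converge to `f` in `X`.

For the upper bound, the mean is first replaced by a supremum. By Markov's inequality `ω` is bounded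
by a multiple of its mean off a small part of the ball. The identity `iterDiff_eq_sum_auxiliary`
expresses `Δ_h^k` through differences with steps `j s` and `h + j s`, and for `|h| ≤ t / 2` there is
an `s` for which none of these is exceptional (`exists_le_mean_of_subadditive`); no convexity in `p`
is involved. Next, for a mollification `F` of `f`, a combination `F₁` of Steklov means of `F` at the
scales `a, 2a, …, ka`, with `a` comparable to `t`, satisfies `F - F₁ = ±` a mean of `Δ_y^k F` over
`y`. Its derivatives of order `k` are means of mixed differences divided by powers of the scale, and
mixed differences are combinations of translated pure ones (`diffList_ofFn_eq_sum_iterDiff`). So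
both `‖F - F₁‖_X` and `t ^ k ‖F₁‖_{Ẇ^k X}` are bounded by the supremum of `ω`
(`RISpace.exists_smooth_approximation`, `RISpace.kFunctional_le`).
-/

/-! ### Norms in rearrangement invariant spaces and Minkowski's inequality -/

namespace RISpace

open Filter Topology ProbabilityTheory

variable {N : ℕ} {𝕜 : Type*} [RCLike 𝕜]

local notation "𝔼" => EuclideanSpace ℝ (Fin N)

theorem norm_mono (X : RISpace N) {f g : 𝔼 → 𝕜} (hf : AEStronglyMeasurable f volume)
    (hg : AEStronglyMeasurable g volume) (h : ∀ᵐ x ∂volume, ‖f x‖ₑ ≤ ‖g x‖ₑ) :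
    X.norm f ≤ X.norm g :=
  X.fnorm_mono _ _ hg.enorm hf.enorm h

theorem norm_congr (X : RISpace N) {f g : 𝔼 → 𝕜} (hf : AEStronglyMeasurable f volume)
    (h : f =ᵐ[volume] g) : X.norm f = X.norm g := by
  have hg := hf.congr h
  refine le_antisymm (X.norm_mono hf hg ?_) (X.norm_mono hg hf ?_) <;>
  · filter_upwards [h] with x hx
    rw [hx]

theorem norm_add_le (X : RISpace N) {f g : 𝔼 → 𝕜} (hf : AEStronglyMeasurable f volume)
    (hg : AEStronglyMeasurable g volume) :
    X.norm (fun x => f x + g x) ≤ X.norm f + X.norm g := by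
  refine (X.fnorm_mono _ _ (hf.enorm.add hg.enorm) (hf.add hg).enorm ?_).trans
    (X.fnorm_add_le _ _ hf.enorm hg.enorm)
  exact ae_of_all _ fun x => enorm_add_le _ _

theorem norm_const_mul (X : RISpace N) (a : 𝕜) {f : 𝔼 → 𝕜}
    (hf : AEStronglyMeasurable f volume) :
    X.norm (fun x => a * f x) = ‖a‖ₑ * X.norm f := by
  have h := X.fnorm_smul ‖a‖₊ _ hf.enorm
  simp only [← enorm_eq_nnnorm, ← enorm_mul] at h
  exact h

theorem norm_real_smul (X : RISpace N) (a : ℝ) {f : 𝔼 → 𝕜}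
    (hf : AEStronglyMeasurable f volume) :
    X.norm (fun x => a • f x) = ‖a‖ₑ * X.norm f := by
  have := X.norm_const_mul (a : 𝕜) hf
  simp only [← RCLike.real_smul_eq_coe_mul] at this
  rw [this]
  congr 1
  simp [enorm_eq_nnnorm]

theorem norm_zero (X : RISpace N) : X.norm (fun _ => (0 : 𝕜)) = 0 := by
  unfold norm
  rw [X.fnorm_eq_zero_iff _ aemeasurable_const.enorm]
  filter_upwards with x
  simp

theorem norm_sub_le (X : RISpace N) {f g : 𝔼 → 𝕜} (hf : AEStronglyMeasurable f volume)
    (hg : AEStronglyMeasurable g volume) :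
    X.norm (fun x => f x - g x) ≤ X.norm f + X.norm g := by
  have h1 := X.norm_add_le hf hg.neg
  have h2 := X.norm_const_mul (-1 : 𝕜) hg
  simp only [neg_mul, one_mul, enorm_neg, enorm_one] at h2
  simp only [Pi.neg_apply, ← sub_eq_add_neg] at h1
  exact h1.trans (add_le_add le_rfl h2.le)

theorem norm_sum_le (X : RISpace N) {ι : Type*} (s : Finset ι) {f : ι → 𝔼 → 𝕜}
    (hf : ∀ i ∈ s, AEStronglyMeasurable (f i) volume) :
    X.norm (fun x => ∑ i ∈ s, f i x) ≤ ∑ i ∈ s, X.norm (f i) := by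
  classical
  induction s using Finset.induction_on with
  | empty => simp [X.norm_zero]
  | insert a s ha ih =>
    simp only [Finset.sum_insert ha]
    refine (X.norm_add_le (hf a (Finset.mem_insert_self _ _)) ?_).trans
      (add_le_add le_rfl (ih fun i hi => hf i (Finset.mem_insert_of_mem hi)))
    exact Finset.aestronglyMeasurable_fun_sum _ fun i hi => hf i (Finset.mem_insert_of_mem hi)

theorem _root_.MeasureTheory.AEStronglyMeasurable.comp_translate {f : 𝔼 → 𝕜}
    (hf : AEStronglyMeasurable f volume) (h : 𝔼) :
    AEStronglyMeasurable (fun x => f (x + h)) volume :=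
  hf.comp_quasiMeasurePreserving
    (measurePreserving_add_right volume h).quasiMeasurePreserving

/-- Translates of a function are equimeasurable with it, so they have the same norm. -/
theorem norm_translate (X : RISpace N) {f : 𝔼 → 𝕜} (hf : AEStronglyMeasurable f volume) (h : 𝔼) :
    X.norm (fun x => f (x + h)) = X.norm f := by
  refine X.fnorm_rearrangement _ _ (hf.comp_translate h).enorm hf.enorm fun l => ?_
  have := (measurePreserving_add_right (volume : Measure 𝔼) h).measure_preimage
    (nullMeasurableSet_lt aemeasurable_const hf.enorm : NullMeasurableSet {x | l < ‖f x‖ₑ} volume)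
  exact this

/-- The Fatou property in the form of a lower semicontinuity of the norm under pointwise
almost everywhere convergence. -/
theorem norm_le_of_tendsto (X : RISpace N) {g : ℕ → 𝔼 → 𝕜} {f : 𝔼 → 𝕜} {M : ℝ≥0∞}
    (hg : ∀ n, AEStronglyMeasurable (g n) volume)
    (hlim : ∀ᵐ x ∂volume, Tendsto (fun n => g n x) atTop (𝓝 (f x)))
    (hM : ∀ n, X.norm (g n) ≤ M) : X.norm f ≤ M := by
  have hf : AEStronglyMeasurable f volume := aestronglyMeasurable_of_tendsto_ae _ hg hlim
  have hinf : ∀ n, AEMeasurable (fun x => ⨅ m, ‖g (n + m) x‖ₑ) volume := fun n =>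
    AEMeasurable.iInf fun m => (hg (n + m)).enorm
  have hmono : ∀ x, Monotone fun n => ⨅ m, ‖g (n + m) x‖ₑ := by
    intro x
    refine monotone_nat_of_le_succ fun n => le_iInf fun m => ?_
    refine (iInf_le _ (m + 1)).trans (le_of_eq ?_)
    congr 2
    ring
  calc X.norm f ≤ X.fnorm (fun x => ⨆ n, ⨅ m, ‖g (n + m) x‖ₑ) := by
        refine X.fnorm_mono _ _ (AEMeasurable.iSup hinf) hf.enorm ?_
        filter_upwards [hlim] with x hx
        have hx' : Tendsto (fun n => ‖g n x‖ₑ) atTop (𝓝 ‖f x‖ₑ) :=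
          (continuous_enorm.tendsto _).comp hx
        rw [← hx'.liminf_eq, liminf_eq_iSup_iInf_of_nat']
        simp only [add_comm]
        exact le_rfl
    _ = ⨆ n, X.fnorm (fun x => ⨅ m, ‖g (n + m) x‖ₑ) :=
        X.fnorm_iSup _ hinf (ae_of_all _ hmono)
    _ ≤ M := by
        refine iSup_le fun n => (X.fnorm_mono _ _ (hg n).enorm (hinf n) ?_).trans (hM n)
        exact ae_of_all _ fun x => iInf_le (fun m => ‖g (n + m) x‖ₑ) 0

/-- Minkowski's inequality for averages of jointly measurable families. By the strong law of large
numbers, for almost every sample of parameters the finite means of the family converge almost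
everywhere to its average, and finite means are controlled by the triangle inequality. -/
theorem norm_integral_le_of_measurable (X : RISpace N) {Ω : Type*} [MeasurableSpace Ω]
    (μ : Measure Ω) [IsProbabilityMeasure μ] {g : Ω → 𝔼 → 𝕜}
    (hg : Measurable (Function.uncurry g))
    (hint : ∀ᵐ x ∂(volume : Measure 𝔼), Integrable (fun ω => g ω x) μ) {M : ℝ≥0∞}
    (hM : ∀ᵐ ω ∂μ, X.norm (g ω) ≤ M) :
    X.norm (fun x => ∫ ω, g ω x ∂μ) ≤ M := by
  set P : Measure (ℕ → Ω) := Measure.infinitePi fun _ => μ with hP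
  set G : 𝔼 → 𝕜 := fun x => ∫ ω, g ω x ∂μ with hG
  have hGm : Measurable G := by
    have : StronglyMeasurable G :=
      StronglyMeasurable.integral_prod_right (f := fun x ω => g ω x)
        (hg.comp measurable_swap).stronglyMeasurable
    exact this.measurable
  set A : ℕ → 𝔼 → (ℕ → Ω) → 𝕜 := fun n x ξ => (n : ℝ)⁻¹ • ∑ i ∈ Finset.range n, g (ξ i) x with hA
  have hgi : ∀ i : ℕ, Measurable fun z : 𝔼 × (ℕ → Ω) => g (z.2 i) z.1 := by
    intro i
    have hp : Measurable fun z : 𝔼 × (ℕ → Ω) => (z.2 i, z.1) :=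
      ((measurable_pi_apply i).comp measurable_snd).prodMk measurable_fst
    exact hg.comp hp
  have hAm : ∀ n, Measurable fun z : 𝔼 × (ℕ → Ω) => A n z.1 z.2 := fun n =>
    (Finset.measurable_fun_sum _ fun i _ => hgi i).const_smul _
  have hset : MeasurableSet {z : 𝔼 × (ℕ → Ω) |
      Tendsto (fun n => A n z.1 z.2) atTop (𝓝 (G z.1))} :=
    measurableSet_tendsto_fun hAm (hGm.comp measurable_fst)
  have hslln : ∀ᵐ x ∂(volume : Measure 𝔼), ∀ᵐ ξ ∂P,
      Tendsto (fun n => A n x ξ) atTop (𝓝 (G x)) := by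
    filter_upwards [hint] with x hx
    have hgx : Measurable fun ω => g ω x := hg.comp measurable_prodMk_right
    have hmp : ∀ i : ℕ, MeasurePreserving (fun ξ : ℕ → Ω => ξ i) P μ := fun i =>
      measurePreserving_eval_infinitePi (fun _ => μ) i
    have hind : iIndepFun (fun (i : ℕ) (ξ : ℕ → Ω) => g (ξ i) x) P :=
      iIndepFun_infinitePi (X := fun _ ω => g ω x) fun _ => hgx
    have h0 : ∫ ξ, g (ξ 0) x ∂P = G x := by
      have := (hmp 0).map_eq
      rw [hG]
      simp only
      rw [← this, integral_map (hmp 0).measurable.aemeasurable hgx.aestronglyMeasurable]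
    have := strong_law_ae (μ := P) (fun (i : ℕ) (ξ : ℕ → Ω) => g (ξ i) x)
      ((hmp 0).integrable_comp_of_integrable hx)
      (fun i j hij => hind.indepFun hij)
      (fun i => ⟨(hgx.comp (hmp i).measurable).aemeasurable,
        (hgx.comp (hmp 0).measurable).aemeasurable, by
          have key : ∀ i : ℕ, Measure.map (fun ξ : ℕ → Ω => g (ξ i) x) P
              = Measure.map (fun ω => g ω x) μ := by
            intro i
            rw [← (hmp i).map_eq, Measure.map_map hgx (hmp i).measurable]
            rfl
          rw [key i, key 0]⟩)
    rw [h0] at this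
    exact this
  have hswap := (Measure.ae_ae_comm (μ := (volume : Measure 𝔼)) (ν := P) hset).1 hslln
  have hMall : ∀ᵐ ξ ∂P, ∀ i, X.norm (g (ξ i)) ≤ M := by
    rw [ae_all_iff]
    intro i
    exact (measurePreserving_eval_infinitePi (fun _ => μ) i).quasiMeasurePreserving.ae hM
  obtain ⟨ξ, hξ, hξM⟩ := (hswap.and hMall).exists
  have hgm : ∀ ω, AEStronglyMeasurable (g ω) (volume : Measure 𝔼) := fun ω =>
    (hg.comp measurable_prodMk_left).aestronglyMeasurable
  refine X.norm_le_of_tendsto (g := fun n x => A n x ξ) (fun n => ?_) hξ fun n => ?_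
  · exact (Finset.aestronglyMeasurable_fun_sum _ fun i _ => hgm (ξ i)).const_smul _
  · rw [hA]
    simp only
    rw [X.norm_real_smul _ (Finset.aestronglyMeasurable_fun_sum _ fun i _ => hgm (ξ i))]
    rcases Nat.eq_zero_or_pos n with rfl | hn
    · simp
    calc ‖(n : ℝ)⁻¹‖ₑ * X.norm (fun x => ∑ i ∈ Finset.range n, g (ξ i) x)
        ≤ ‖(n : ℝ)⁻¹‖ₑ * ∑ i ∈ Finset.range n, X.norm (g (ξ i)) := by
          gcongr
          exact X.norm_sum_le _ fun i _ => hgm (ξ i)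
      _ ≤ ‖(n : ℝ)⁻¹‖ₑ * (n * M) := by
          gcongr
          refine (Finset.sum_le_sum fun i _ => hξM i).trans ?_
          simp
      _ = M := by
          rw [← mul_assoc, enorm_inv (by positivity), Real.enorm_natCast,
            ENNReal.inv_mul_cancel (by positivity) (by simp), one_mul]

/-- Minkowski's inequality for averages: the norm of an average is at most an essential upper bound
of the norms. The family is replaced by a measurable version, equal to it almost everywhere. -/
theorem norm_integral_le (X : RISpace N) {Ω : Type*} [MeasurableSpace Ω]
    (μ : Measure Ω) [IsProbabilityMeasure μ] {g : Ω → 𝔼 → 𝕜}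
    (hg : AEStronglyMeasurable (Function.uncurry g) (μ.prod volume))
    (hint : ∀ᵐ x ∂(volume : Measure 𝔼), Integrable (fun ω => g ω x) μ) {M : ℝ≥0∞}
    (hM : ∀ᵐ ω ∂μ, X.norm (g ω) ≤ M) :
    X.norm (fun x => ∫ ω, g ω x ∂μ) ≤ M := by
  set g' : Ω → 𝔼 → 𝕜 := fun ω x => hg.mk _ (ω, x) with hg'
  have hm : Measurable (Function.uncurry g') := hg.stronglyMeasurable_mk.measurable
  have h1 : ∀ᵐ ω ∂μ, ∀ᵐ x ∂volume, g ω x = g' ω x := Measure.ae_ae_of_ae_prod hg.ae_eq_mk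
  have h2 : ∀ᵐ x ∂(volume : Measure 𝔼), ∀ᵐ ω ∂μ, g ω x = g' ω x :=
    Measure.ae_ae_of_ae_prod
      ((Measure.measurePreserving_swap (μ := (volume : Measure 𝔼))
        (ν := μ)).quasiMeasurePreserving.ae hg.ae_eq_mk)
  have hm' : ∀ ω, AEStronglyMeasurable (g' ω) (volume : Measure 𝔼) := fun ω =>
    (hm.comp measurable_prodMk_left).aestronglyMeasurable
  have hGm : StronglyMeasurable fun x => ∫ ω, g' ω x ∂μ :=
    StronglyMeasurable.integral_prod_right (f := fun x ω => g' ω x)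
      (hm.comp measurable_swap).stronglyMeasurable
  have hcongr : (fun x => ∫ ω, g' ω x ∂μ) =ᵐ[volume] fun x => ∫ ω, g ω x ∂μ := by
    filter_upwards [h2] with x hx
    exact integral_congr_ae (hx.mono fun ω h => h.symm)
  rw [← X.norm_congr hGm.aestronglyMeasurable hcongr]
  refine X.norm_integral_le_of_measurable μ hm ?_ ?_
  · filter_upwards [hint, h2] with x hx hx2
    exact hx.congr hx2
  · filter_upwards [hM, h1] with ω hω h1ω
    rwa [X.norm_congr (hm' ω) (h1ω.mono fun x h => h.symm)]

end RISpace

/-! ### Means, differences and directional derivatives -/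

section Difference

variable {V G : Type*} [AddCommGroup V] [AddCommGroup G]

/-- The first difference of `Q` with step `v`. -/
def diffAlong (v : V) (Q : V → G) (y : V) : G :=
  Q (y + v) - Q y

/-- The mixed difference of `Q` whose steps are the vectors of a list. -/
def diffList (L : List V) (Q : V → G) : V → G :=
  L.foldr diffAlong Q

@[simp] theorem diffList_nil (Q : V → G) : diffList [] Q = Q := rfl
@[simp] theorem diffList_cons (v : V) (L : List V) (Q : V → G) :
    diffList (v :: L) Q = diffAlong v (diffList L Q) := rfl

end Difference

theorem intervalIntegrable_segment {V G : Type*} [NormedAddCommGroup V] [NormedSpace ℝ V]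
    [NormedAddCommGroup G] (v y : V) {Q : V → G} (hQ : Continuous Q) :
    IntervalIntegrable (fun w : ℝ => Q (y + w • v)) volume 0 1 :=
  Continuous.intervalIntegrable (by fun_prop) _ _

section AverageAlong

variable {V W : Type*} [NormedAddCommGroup V] [NormedSpace ℝ V]
  [NormedAddCommGroup W] [NormedSpace ℝ W]
  {G : Type*} [NormedAddCommGroup G] [NormedSpace ℝ G]

/-- The mean of `Q` over the segment from `y` to `y + v`, as a function of `y`. -/
noncomputable def aveAlong (v : V) (Q : V → G) (y : V) : G :=
  ∫ w in (0 : ℝ)..1, Q (y + w • v)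

/-- The iterated means of `Q` along the vectors of a list. -/
noncomputable def aveList (L : List V) (Q : V → G) : V → G :=
  L.foldr aveAlong Q

/-- The derivative of `Q` in the direction `v`. -/
noncomputable def dirDeriv (v : V) (Q : V → G) (y : V) : G :=
  fderiv ℝ Q y v

/-- The iterated directional derivative of `Q` along the vectors of a list. -/
noncomputable def dirDerivList (L : List V) (Q : V → G) : V → G :=
  L.foldr dirDeriv Q

/-- `Q` is infinitely differentiable. -/
abbrev Smooth (Q : V → G) : Prop :=
  ContDiff ℝ ((⊤ : ℕ∞) : WithTop ℕ∞) Q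

@[simp] theorem aveList_nil (Q : V → G) : aveList [] Q = Q := rfl
@[simp] theorem aveList_cons (v : V) (L : List V) (Q : V → G) :
    aveList (v :: L) Q = aveAlong v (aveList L Q) := rfl
@[simp] theorem dirDerivList_nil (Q : V → G) : dirDerivList [] Q = Q := rfl
@[simp] theorem dirDerivList_cons (v : V) (L : List V) (Q : V → G) :
    dirDerivList (v :: L) Q = dirDeriv v (dirDerivList L Q) := rfl

theorem aveList_append (L L' : List V) (Q : V → G) :
    aveList (L ++ L') Q = aveList L (aveList L' Q) := List.foldr_append
theorem dirDerivList_append (L L' : List V) (Q : V → G) :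
    dirDerivList (L ++ L') Q = dirDerivList L (dirDerivList L' Q) := List.foldr_append

theorem continuous_aveAlong (v : V) {Q : V → G} (hQ : Continuous Q) :
    Continuous (aveAlong v Q) :=
  intervalIntegral.continuous_parametric_intervalIntegral_of_continuous'
    (f := fun y w => Q (y + w • v)) (by fun_prop) 0 1

theorem continuous_aveList (L : List V) {Q : V → G} (hQ : Continuous Q) :
    Continuous (aveList L Q) := by
  induction L with
  | nil => exact hQ
  | cons v L ih => exact continuous_aveAlong v ih

theorem aveAlong_comm (v w : V) {Q : V → G} (hQ : Continuous Q) :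
    aveAlong v (aveAlong w Q) = aveAlong w (aveAlong v Q) := by
  funext y
  unfold aveAlong
  rw [intervalIntegral_intervalIntegral_swap]
  · simp only [add_right_comm]
  · rw [Set.uIoc_of_le zero_le_one]
    have hc : Continuous (Function.uncurry fun a b : ℝ => Q (y + a • v + b • w)) := by
      unfold Function.uncurry
      fun_prop
    exact (hc.continuousOn.integrableOn_compact (isCompact_Icc.prod isCompact_Icc)).mono_set
      (Set.prod_mono Set.Ioc_subset_Icc_self Set.Ioc_subset_Icc_self)

theorem aveList_perm {L L' : List V} (h : L.Perm L') {Q : V → G} (hQ : Continuous Q) :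
    aveList L Q = aveList L' Q := by
  induction h with
  | nil => rfl
  | cons v _ ih => simp only [aveList_cons, ih]
  | swap v w L => exact aveAlong_comm _ _ (continuous_aveList L hQ)
  | trans _ _ ih1 ih2 => exact ih1.trans ih2

theorem aveAlong_sub (v : V) {Q R : V → G} (hQ : Continuous Q) (hR : Continuous R) :
    aveAlong v (fun y => Q y - R y) = fun y => aveAlong v Q y - aveAlong v R y := by
  funext y
  exact intervalIntegral.integral_sub (intervalIntegrable_segment v y hQ)
    (intervalIntegrable_segment v y hR)

theorem aveAlong_smul (v : V) (c : ℝ) (Q : V → G) :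
    aveAlong v (fun y => c • Q y) = fun y => c • aveAlong v Q y := by
  funext y
  exact intervalIntegral.integral_smul c _

theorem aveAlong_sum {ι : Type*} (s : Finset ι) (v : V) {Q : ι → V → G}
    (hQ : ∀ i ∈ s, Continuous (Q i)) :
    aveAlong v (fun y => ∑ i ∈ s, Q i y) = fun y => ∑ i ∈ s, aveAlong v (Q i) y := by
  funext y
  exact intervalIntegral.integral_finsetSum fun i hi => intervalIntegrable_segment v y (hQ i hi)

theorem aveAlong_comp_clm (ℓ : V →L[ℝ] W) (v : V) (Q : W → G) :
    aveAlong v (fun y => Q (ℓ y)) = fun y => aveAlong (ℓ v) Q (ℓ y) := by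
  funext y
  simp only [aveAlong, map_add, map_smul]

theorem aveList_comp_clm (ℓ : V →L[ℝ] W) (L : List V) (Q : W → G) :
    aveList L (fun y => Q (ℓ y)) = fun y => aveList (L.map ℓ) Q (ℓ y) := by
  induction L with
  | nil => rfl
  | cons v L ih => rw [aveList_cons, ih, List.map_cons, aveList_cons, aveAlong_comp_clm]

theorem aveList_sum_smul {ι : Type*} (s : Finset ι) (L : List V) (c : ι → ℝ) {Q : ι → V → G}
    (hQ : ∀ i ∈ s, Continuous (Q i)) :
    aveList L (fun y => ∑ i ∈ s, c i • Q i y) = fun y => ∑ i ∈ s, c i • aveList L (Q i) y := by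
  induction L with
  | nil => rfl
  | cons v L ih =>
    rw [aveList_cons, ih, aveAlong_sum s v (Q := fun i y => c i • aveList L (Q i) y)
      fun i hi => (continuous_aveList L (hQ i hi)).const_smul (c i)]
    simp only [aveAlong_smul, aveList_cons]

theorem diffAlong_aveAlong (v w : V) {Q : V → G} (hQ : Continuous Q) :
    diffAlong v (aveAlong w Q) = aveAlong w (diffAlong v Q) := by
  have h := aveAlong_sub w (R := Q) (Q := fun y => Q (y + v)) (by fun_prop) hQ
  unfold diffAlong
  rw [h]
  simp only [aveAlong, add_right_comm]

theorem diffAlong_aveList (v : V) (L : List V) {Q : V → G} (hQ : Continuous Q) :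
    diffAlong v (aveList L Q) = aveList L (diffAlong v Q) := by
  induction L with
  | nil => rfl
  | cons w L ih => rw [aveList_cons, diffAlong_aveAlong _ _ (continuous_aveList L hQ), ih]; rfl

theorem Smooth.dirDeriv {Q : V → G} (hQ : Smooth Q) (v : V) : Smooth (dirDeriv v Q) := by
  have h : Smooth (fderiv ℝ Q) := (contDiff_infty_iff_fderiv.1 hQ).2
  exact h.clm_apply contDiff_const

theorem Smooth.dirDerivList {Q : V → G} (hQ : Smooth Q) (L : List V) :
    Smooth (dirDerivList L Q) := by
  induction L with
  | nil => exact hQ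
  | cons v L ih => exact ih.dirDeriv v

theorem Smooth.differentiable {Q : V → G} (hQ : Smooth Q) : Differentiable ℝ Q :=
  (contDiff_infty_iff_fderiv.1 hQ).1

/-- The fundamental theorem of calculus: a first difference is the mean of the derivative. -/
theorem diffAlong_eq_aveAlong_dirDeriv [CompleteSpace G] (v : V) {Q : V → G} (hQ : Smooth Q) :
    diffAlong v Q = aveAlong v (dirDeriv v Q) := by
  funext y
  have hd : ∀ w : ℝ, HasDerivAt (fun w : ℝ => Q (y + w • v)) (dirDeriv v Q (y + w • v)) w := by
    intro w
    have h1 : HasDerivAt (fun w : ℝ => y + w • v) v w := by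
      simpa using ((hasDerivAt_id w).smul_const v).const_add y
    exact (hQ.differentiable _).hasFDerivAt.comp_hasDerivAt w h1
  have := intervalIntegral.integral_eq_sub_of_hasDerivAt (a := (0 : ℝ)) (b := 1)
    (fun w _ => hd w) (intervalIntegrable_segment v y (hQ.dirDeriv v).continuous)
  unfold aveAlong diffAlong
  rw [this]
  simp

/-- A mixed difference of a smooth function is an iterated mean of the mixed derivative. -/
theorem diffList_eq_aveList_dirDerivList [CompleteSpace G] (L : List V) {Q : V → G}
    (hQ : Smooth Q) : diffList L Q = aveList L (dirDerivList L Q) := by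
  induction L with
  | nil => rfl
  | cons v L ih =>
    rw [diffList_cons, ih, diffAlong_aveList _ _ (hQ.dirDerivList L).continuous,
      diffAlong_eq_aveAlong_dirDeriv v (hQ.dirDerivList L), ← dirDerivList_cons]
    -- the new mean stands innermost, and means commute
    have : aveList L (aveAlong v (dirDerivList (v :: L) Q))
        = aveList (L ++ [v]) (dirDerivList (v :: L) Q) := by
      rw [aveList_append]; rfl
    rw [this]
    exact aveList_perm (List.perm_append_singleton v L) (hQ.dirDerivList _).continuous

theorem dirDeriv_comm (v w : V) {Q : V → G} (hQ : Smooth Q) :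
    dirDeriv v (dirDeriv w Q) = dirDeriv w (dirDeriv v Q) := by
  have h : Smooth (fderiv ℝ Q) := (contDiff_infty_iff_fderiv.1 hQ).2
  have key : ∀ (a b : V) y, dirDeriv a (dirDeriv b Q) y = fderiv ℝ (fderiv ℝ Q) y a b := by
    intro a b y
    unfold dirDeriv
    rw [fderiv_clm_apply (h.differentiable y) (differentiableAt_const b)]
    simp
  funext y
  rw [key, key]
  have hs : IsSymmSndFDerivAt ℝ Q y :=
    hQ.contDiffAt.isSymmSndFDerivAt
      (by simpa using WithTop.coe_le_coe.2 (le_top : (2 : ℕ∞) ≤ ⊤))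
  exact hs v w

theorem dirDerivList_perm {L L' : List V} (h : L.Perm L') {Q : V → G} (hQ : Smooth Q) :
    dirDerivList L Q = dirDerivList L' Q := by
  induction h with
  | nil => rfl
  | cons v _ ih => simp only [dirDerivList_cons, ih]
  | swap v w L => exact dirDeriv_comm _ _ (hQ.dirDerivList L)
  | trans _ _ ih1 ih2 => exact ih1.trans ih2

theorem dirDeriv_sum_smul {ι : Type*} (s : Finset ι) (v : V) (c : ι → ℝ) {Q : ι → V → G}
    (hQ : ∀ i ∈ s, Smooth (Q i)) :
    dirDeriv v (fun y => ∑ i ∈ s, c i • Q i y) = fun y => ∑ i ∈ s, c i • dirDeriv v (Q i) y := by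
  funext y
  unfold dirDeriv
  rw [fderiv_fun_sum fun i hi => ((hQ i hi).differentiable y).fun_const_smul (c i)]
  rw [sum_apply]
  refine Finset.sum_congr rfl fun i hi => ?_
  rw [fderiv_fun_const_smul ((hQ i hi).differentiable y)]
  rfl

theorem Smooth.sum_smul {ι : Type*} (s : Finset ι) (c : ι → ℝ) {Q : ι → V → G}
    (hQ : ∀ i ∈ s, Smooth (Q i)) : Smooth (fun y => ∑ i ∈ s, c i • Q i y) :=
  ContDiff.sum fun i hi => (hQ i hi).const_smul (c i)

theorem dirDerivList_sum_smul {ι : Type*} (s : Finset ι) (L : List V) (c : ι → ℝ) {Q : ι → V → G}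
    (hQ : ∀ i ∈ s, Smooth (Q i)) :
    dirDerivList L (fun y => ∑ i ∈ s, c i • Q i y)
      = fun y => ∑ i ∈ s, c i • dirDerivList L (Q i) y := by
  induction L with
  | nil => rfl
  | cons v L ih =>
    rw [dirDerivList_cons, ih, dirDeriv_sum_smul s v c fun i hi => (hQ i hi).dirDerivList L]
    rfl

theorem dirDeriv_smul_left (a : ℝ) (v : V) (Q : V → G) :
    dirDeriv (a • v) Q = fun y => a • dirDeriv v Q y := by
  funext y
  simp [dirDeriv]

theorem dirDerivList_map_smul (a : ℝ) (L : List V) {Q : V → G} (hQ : Smooth Q) :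
    dirDerivList (L.map (a • ·)) Q = fun y => a ^ L.length • dirDerivList L Q y := by
  induction L with
  | nil => simp
  | cons v L ih =>
    rw [List.map_cons, dirDerivList_cons, ih, dirDeriv_smul_left]
    funext y
    have := dirDeriv_sum_smul (Finset.univ : Finset Unit) v (fun _ => a ^ L.length)
      (Q := fun _ => dirDerivList L Q) fun _ _ => hQ.dirDerivList L
    simp only [Finset.univ_unique, Finset.sum_singleton] at this
    rw [this, smul_smul, List.length_cons, pow_succ']
    rfl

end AverageAlong

section SmoothAverage

-- `V` lives in `Type`, so that `Q` and `fderiv ℝ Q` take values in the same universe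
universe u
variable {V : Type} [NormedAddCommGroup V] [NormedSpace ℝ V] [ProperSpace V]

theorem hasFDerivAt_aveAlong {G : Type u} [NormedAddCommGroup G] [NormedSpace ℝ G] (v : V)
    {Q : V → G} (hQ : ContDiff ℝ 1 Q) (y : V) :
    HasFDerivAt (aveAlong v Q) (aveAlong v (fderiv ℝ Q) y) y := by
  have hc : Continuous (fderiv ℝ Q) := hQ.continuous_fderiv one_ne_zero
  obtain ⟨C, hC⟩ := ((isCompact_closedBall y 1).prod (isCompact_Icc (a := (0 : ℝ)) (b := 1))
    ).exists_bound_of_continuousOn (f := fun z : V × ℝ => fderiv ℝ Q (z.1 + z.2 • v))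
    (by fun_prop)
  refine (intervalIntegral.hasFDerivAt_integral_of_dominated_of_fderiv_le
    (F := fun y w => Q (y + w • v)) (F' := fun y w => fderiv ℝ Q (y + w • v))
    (bound := fun _ => C) (Metric.ball_mem_nhds y one_pos) ?_ ?_ ?_ ?_ ?_ ?_)
  · exact Filter.Eventually.of_forall fun z =>
      (Continuous.aestronglyMeasurable (by have := hQ.continuous; fun_prop))
  · exact intervalIntegrable_segment v y hQ.continuous
  · exact Continuous.aestronglyMeasurable (by fun_prop)
  · refine Filter.Eventually.of_forall fun w hw z hz =>
      hC (z, w) ⟨Metric.ball_subset_closedBall hz, ?_⟩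
    rw [Set.uIoc_of_le zero_le_one] at hw
    exact ⟨hw.1.le, hw.2⟩
  · exact intervalIntegrable_const
  · refine Filter.Eventually.of_forall fun w _ z _ => ?_
    exact ((hasFDerivAt_comp_add_right (w • v)).2
      (hQ.differentiable one_ne_zero (z + w • v)).hasFDerivAt)

theorem contDiff_aveAlong (v : V) (n : ℕ) : ∀ {G : Type u} [NormedAddCommGroup G] [NormedSpace ℝ G]
    {Q : V → G}, ContDiff ℝ n Q → ContDiff ℝ n (aveAlong v Q) := by
  induction n with
  | zero =>
    intro G _ _ Q hQ
    exact contDiff_zero.2 (continuous_aveAlong v (contDiff_zero.1 hQ))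
  | succ n ih =>
    intro G _ _ Q hQ
    have h1 : ContDiff ℝ 1 Q := hQ.of_le (by norm_cast; omega)
    push_cast at hQ ⊢
    rw [contDiff_succ_iff_fderiv] at hQ ⊢
    refine ⟨fun y => (hasFDerivAt_aveAlong v h1 y).differentiableAt, by simp, ?_⟩
    have : fderiv ℝ (aveAlong v Q) = aveAlong v (fderiv ℝ Q) := by
      funext y
      exact (hasFDerivAt_aveAlong v h1 y).fderiv
    rw [this]
    exact ih hQ.2.2

theorem Smooth.aveAlong {G : Type u} [NormedAddCommGroup G] [NormedSpace ℝ G] (v : V) {Q : V → G}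
    (hQ : Smooth Q) : Smooth (aveAlong v Q) :=
  contDiff_infty.2 fun n => contDiff_aveAlong v n (contDiff_infty.1 hQ n)

theorem Smooth.aveList {G : Type u} [NormedAddCommGroup G] [NormedSpace ℝ G] (L : List V)
    {Q : V → G} (hQ : Smooth Q) : Smooth (aveList L Q) := by
  induction L with
  | nil => exact hQ
  | cons v L ih => exact ih.aveAlong v

theorem dirDeriv_aveAlong {G : Type u} [NormedAddCommGroup G] [NormedSpace ℝ G] [CompleteSpace G]
    (v w : V) {Q : V → G} (hQ : Smooth Q) :
    dirDeriv w (aveAlong v Q) = aveAlong v (dirDeriv w Q) := by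
  funext y
  have h1 : ContDiff ℝ 1 Q := hQ.of_le (by norm_cast)
  unfold dirDeriv
  rw [(hasFDerivAt_aveAlong v h1 y).fderiv]
  exact (ContinuousLinearMap.intervalIntegral_apply
    (intervalIntegrable_segment v y (h1.continuous_fderiv one_ne_zero)) w)

theorem dirDeriv_aveList {G : Type u} [NormedAddCommGroup G] [NormedSpace ℝ G] [CompleteSpace G]
    (L : List V) (w : V) {Q : V → G} (hQ : Smooth Q) :
    dirDeriv w (aveList L Q) = aveList L (dirDeriv w Q) := by
  induction L with
  | nil => rfl
  | cons v L ih => rw [aveList_cons, dirDeriv_aveAlong v w (hQ.aveList L), ih]; rfl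

theorem dirDerivList_aveList {G : Type u} [NormedAddCommGroup G] [NormedSpace ℝ G]
    [CompleteSpace G] (L M : List V) {Q : V → G} (hQ : Smooth Q) :
    dirDerivList M (aveList L Q) = aveList L (dirDerivList M Q) := by
  induction M with
  | nil => rfl
  | cons w M ih =>
    rw [dirDerivList_cons, ih, dirDeriv_aveList L w (hQ.dirDerivList M), ← dirDerivList_cons]

end SmoothAverage

/-! ### Distributional derivatives and mollification -/

section Distributions

open Filter Topology
open scoped Convolution

variable {N : ℕ} {𝕜 : Type*} [RCLike 𝕜]

local notation "𝔼" => EuclideanSpace ℝ (Fin N)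
local notation "𝔻" => TestFunction (⊤ : Opens (EuclideanSpace ℝ (Fin N))) ℝ ⊤
local notation "𝔇" => Distribution (⊤ : Opens (EuclideanSpace ℝ (Fin N))) 𝕜 ⊤

/-- The iterated directional derivative of a distribution along the vectors of a list. -/
noncomputable def distDerivList (L : List 𝔼) (F : 𝔇) : 𝔇 :=
  L.foldr (fun v G => (∂_{v} G : 𝔇)) F

/-- The standard basis vectors of `ℝ^N`, as directions of differentiation. -/
noncomputable abbrev basisVec (i : Fin N) : 𝔼 := EuclideanSpace.single i (1 : ℝ)

/-- The word that lists every coordinate `i` with multiplicity `α i`. -/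
def multiWord (α : Fin N → ℕ) : List (Fin N) :=
  (List.finRange N).flatMap fun i => List.replicate (α i) i

theorem count_multiWord (α : Fin N → ℕ) (i : Fin N) : (multiWord α).count i = α i := by
  have key : ∀ l : List (Fin N), l.Nodup →
      (l.flatMap fun j => List.replicate (α j) j).count i = if i ∈ l then α i else 0 := by
    intro l hl
    induction l with
    | nil => simp
    | cons a l ih =>
      rw [List.nodup_cons] at hl
      rw [List.flatMap_cons, List.count_append, ih hl.2, List.count_replicate]
      by_cases h : a = i
      · subst h
        simp [hl.1]
      · have h' : i ≠ a := fun h2 => h h2.symm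
        simp [h, h']
  rw [multiWord, key _ (List.nodup_finRange N)]
  simp

theorem length_multiWord (α : Fin N → ℕ) : (multiWord α).length = ∑ i, α i := by
  rw [multiWord, List.length_flatMap]
  simp only [List.length_replicate]
  rw [← List.ofFn_eq_map, List.sum_ofFn]

/-- Every word is, up to the order of its letters, the word of a multi-index. -/
theorem exists_perm_multiWord (w : List (Fin N)) :
    ∃ α : Fin N → ℕ, ∑ i, α i = w.length ∧ w.Perm (multiWord α) := by
  have hp : w.Perm (multiWord fun i => w.count i) :=
    List.perm_iff_count.2 fun i => (count_multiWord (fun i => w.count i) i).symm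
  exact ⟨_, by rw [← length_multiWord, hp.length_eq], hp⟩

theorem multiDeriv_eq_distDerivList (α : Fin N → ℕ) (F : 𝔇) :
    multiDeriv α F = distDerivList ((multiWord α).map basisVec) F := by
  have hrep : ∀ (n : ℕ) (v : 𝔼) (G : 𝔇),
      (List.replicate n v).foldr (fun v G => (∂_{v} G : 𝔇)) G
        = (fun H : 𝔇 => ∂_{v} H)^[n] G := by
    intro n v G
    induction n with
    | zero => rfl
    | succ n ih => rw [List.replicate_succ, List.foldr_cons, ih, Function.iterate_succ_apply']
  have key : ∀ l : List (Fin N),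
      l.foldr (fun i G => (fun H : 𝔇 => ∂_{EuclideanSpace.single i (1 : ℝ)} H)^[α i] G) F
        = distDerivList ((l.flatMap fun j => List.replicate (α j) j).map basisVec) F := by
    intro l
    induction l with
    | nil => rfl
    | cons a l ih =>
      rw [List.foldr_cons, ih, List.flatMap_cons, List.map_append, distDerivList, distDerivList,
        List.foldr_append, List.map_replicate, hrep]
  exact key _

theorem integrable_testFunction_smul (φ : 𝔻) {f : 𝔼 → 𝕜} (hf : LocallyIntegrable f volume) :
    Integrable (fun x => φ x • f x) volume :=
  hf.integrable_smul_left_of_hasCompactSupport φ.continuous φ.hasCompactSupport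

/-- A locally integrable function is determined almost everywhere by its distribution. -/
theorem ae_eq_of_regularDistribution_eq {f g : 𝔼 → 𝕜} (hf : LocallyIntegrable f volume)
    (hg : LocallyIntegrable g volume) (h : regularDistribution f = regularDistribution g) :
    f =ᵐ[volume] g := by
  refine ae_eq_of_integral_contDiff_smul_eq hf hg fun φ hφ hφ' => ?_
  have := congrArg (fun F : 𝔇 => F ⟨φ, hφ, hφ', fun _ _ => trivial⟩) h
  simp only [regularDistribution_apply hf, regularDistribution_apply hg] at this
  exact this

theorem regularDistribution_add {f g : 𝔼 → 𝕜} (hf : LocallyIntegrable f volume)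
    (hg : LocallyIntegrable g volume) :
    regularDistribution (fun x => f x + g x) = regularDistribution f + regularDistribution g := by
  refine DFunLike.ext _ _ fun φ => ?_
  have hfg : LocallyIntegrable (fun x => f x + g x) volume := hf.add hg
  change _ = regularDistribution f φ + regularDistribution g φ
  rw [regularDistribution_apply hf, regularDistribution_apply hg, regularDistribution_apply hfg,
    ← integral_add (integrable_testFunction_smul φ hf) (integrable_testFunction_smul φ hg)]
  simp only [smul_add]

theorem testFunction_lineDeriv_apply (v : 𝔼) (φ : 𝔻) (x : 𝔼) :
    (∂_{v} φ : 𝔻) x = fderiv ℝ φ x v := by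
  change (TestFunction.lineDerivCLM ℝ v φ : 𝔻) x = _
  rw [TestFunction.lineDerivCLM_eq_fderivCLM, TestFunction.fderivCLM_apply_of_le]
  simp

/-- The distributional derivative of a smooth function is its classical derivative. -/
theorem lineDeriv_regularDistribution {F : 𝔼 → 𝕜} (hF : Smooth F) (v : 𝔼) :
    (∂_{v} (regularDistribution F) : 𝔇) = regularDistribution (dirDeriv v F) := by
  have hF1 : LocallyIntegrable F volume := hF.continuous.locallyIntegrable
  have hF2 : LocallyIntegrable (dirDeriv v F) volume := (hF.dirDeriv v).continuous.locallyIntegrable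
  refine DFunLike.ext _ _ fun φ => ?_
  rw [Distribution.lineDerivOp_apply_apply, map_neg, regularDistribution_apply hF1,
    regularDistribution_apply hF2]
  have := integral_smul_fderiv_eq_neg_fderiv_smul_of_integrable (μ := (volume : Measure 𝔼))
    (f := (φ : 𝔼 → ℝ)) (g := F) (v := v) ?_ (integrable_testFunction_smul φ hF2)
    (integrable_testFunction_smul φ hF1)
    (fun x _ => φ.contDiff.differentiable (by simp) x) (fun x _ => hF.differentiable x)
  · unfold dirDeriv
    rw [this]
    simp only [testFunction_lineDeriv_apply]
  · simpa only [testFunction_lineDeriv_apply] using integrable_testFunction_smul (∂_{v} φ : 𝔻) hF1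

theorem distDerivList_regularDistribution {F : 𝔼 → 𝕜} (hF : Smooth F) (L : List 𝔼) :
    distDerivList L (regularDistribution F) = regularDistribution (dirDerivList L F) := by
  induction L with
  | nil => rfl
  | cons v L ih =>
    rw [dirDerivList_cons, ← lineDeriv_regularDistribution (hF.dirDerivList L), ← ih]
    rfl

/-- The mollification `φ ⋆ f` of `f` by a test function. -/
noncomputable def mollify (φ : 𝔻) (f : 𝔼 → 𝕜) : 𝔼 → 𝕜 :=
  (φ : 𝔼 → ℝ) ⋆[ContinuousLinearMap.lsmul ℝ ℝ, volume] f

theorem mollify_apply (φ : 𝔻) (f : 𝔼 → 𝕜) (x : 𝔼) :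
    mollify φ f x = ∫ y, φ y • f (x - y) := rfl

theorem smooth_mollify (φ : 𝔻) {f : 𝔼 → 𝕜} (hf : LocallyIntegrable f volume) :
    Smooth (mollify φ f) :=
  φ.hasCompactSupport.contDiff_convolution_left _ φ.contDiff hf

theorem integrable_mollify (φ : 𝔻) {f : 𝔼 → 𝕜} (hf : LocallyIntegrable f volume) (x : 𝔼) :
    Integrable (fun y => φ y • f (x - y)) volume :=
  φ.hasCompactSupport.convolutionExists_left
    (ContinuousLinearMap.lsmul ℝ ℝ : ℝ →L[ℝ] 𝕜 →L[ℝ] 𝕜) φ.continuous hf x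

theorem dirDeriv_mollify (φ : 𝔻) {f : 𝔼 → 𝕜} (hf : LocallyIntegrable f volume) (v : 𝔼) :
    dirDeriv v (mollify φ f) = mollify (∂_{v} φ : 𝔻) f := by
  funext x
  have h1 : ContDiff ℝ 1 (φ : 𝔼 → ℝ) := φ.contDiff.of_le (by simp)
  have h := φ.hasCompactSupport.hasFDerivAt_convolution_left
    (ContinuousLinearMap.lsmul ℝ ℝ : ℝ →L[ℝ] 𝕜 →L[ℝ] 𝕜) h1 hf x
  have hex := ((φ.hasCompactSupport.fderiv (𝕜 := ℝ)).convolutionExists_left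
    ((ContinuousLinearMap.lsmul ℝ ℝ : ℝ →L[ℝ] 𝕜 →L[ℝ] 𝕜).precompL 𝔼)
    (h1.continuous_fderiv one_ne_zero) hf) x
  unfold dirDeriv mollify
  rw [h.fderiv, convolution_def, ContinuousLinearMap.integral_apply hex]
  rw [convolution_def]
  simp only [testFunction_lineDeriv_apply]
  rfl

/-- The test function `y ↦ φ (x - y)`. -/
noncomputable def reflect (x : 𝔼) (φ : 𝔻) : 𝔻 :=
  ⟨fun y => φ (x - y), φ.contDiff.comp (contDiff_const.sub contDiff_id),
    φ.hasCompactSupport.comp_homeomorph (Homeomorph.subLeft x), fun _ _ => trivial⟩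

theorem reflect_apply (x : 𝔼) (φ : 𝔻) (y : 𝔼) : reflect x φ y = φ (x - y) := rfl

theorem regularDistribution_reflect (φ : 𝔻) {f : 𝔼 → 𝕜} (hf : LocallyIntegrable f volume)
    (x : 𝔼) : regularDistribution f (reflect x φ) = mollify φ f x := by
  rw [regularDistribution_apply hf]
  unfold mollify
  rw [convolution_lsmul_swap]
  rfl

theorem lineDeriv_reflect (x v : 𝔼) (φ : 𝔻) :
    (-(∂_{v} (reflect x φ)) : 𝔻) = reflect x (∂_{v} φ) := by
  ext y
  have h1 : HasFDerivAt (reflect x φ) (-(fderiv ℝ φ (x - y))) y := by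
    have h2 := (φ.contDiff.differentiable (by simp) (x - y)).hasFDerivAt.comp y
      ((hasFDerivAt_id y).const_sub x)
    rw [ContinuousLinearMap.comp_neg, ContinuousLinearMap.comp_id] at h2
    exact h2
  change -((∂_{v} (reflect x φ) : 𝔻) y) = _
  rw [reflect_apply, testFunction_lineDeriv_apply, testFunction_lineDeriv_apply, h1.fderiv]
  simp

/-- Derivatives of mollifications are mollifications of distributional derivatives. -/
theorem dirDerivList_mollify (φ : 𝔻) {f g : 𝔼 → 𝕜} (hf : LocallyIntegrable f volume)
    (hg : LocallyIntegrable g volume) {L : List 𝔼}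
    (h : distDerivList L (regularDistribution f) = regularDistribution g) :
    dirDerivList L (mollify φ f) = mollify φ g := by
  -- moving the derivatives onto the test function reverses their order
  have h1 : ∀ (L : List 𝔼) (φ : 𝔻) (x : 𝔼),
      distDerivList L (regularDistribution f) (reflect x φ)
        = dirDerivList L.reverse (mollify φ f) x := by
    intro L
    induction L with
    | nil => exact fun φ x => regularDistribution_reflect φ hf x
    | cons v L ih =>
      intro φ x
      rw [List.reverse_cons, dirDerivList_append, dirDerivList_cons, dirDerivList_nil,
        dirDeriv_mollify φ hf, ← ih]
      change (∂_{v} (distDerivList L (regularDistribution f)) : 𝔇) (reflect x φ) = _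
      rw [Distribution.lineDerivOp_apply_apply, lineDeriv_reflect]
  funext x
  rw [dirDerivList_perm L.reverse_perm.symm (smooth_mollify φ hf), ← h1, h,
    regularDistribution_reflect φ hg]

/-- A standard sequence of mollifiers: nonnegative bumps of integral one whose supports shrink
to the origin. -/
theorem exists_mollifiers (N : ℕ) (𝕜 : Type*) [RCLike 𝕜] :
    ∃ φ : ℕ → TestFunction (⊤ : Opens (EuclideanSpace ℝ (Fin N))) ℝ ⊤,
    (∀ n x, 0 ≤ φ n x) ∧ (∀ n, ∫ x, φ n x = 1) ∧
    (∀ n x, φ n x ≠ 0 → ‖x‖ ≤ 2 / ((n : ℝ) + 1)) ∧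
    ∀ f : EuclideanSpace ℝ (Fin N) → 𝕜, LocallyIntegrable f volume →
      ∀ᵐ x ∂volume, Tendsto (fun n => mollify (φ n) f x) atTop (𝓝 (f x)) := by
  have hpos : ∀ n : ℕ, (0 : ℝ) < 1 / ((n : ℝ) + 1) := fun n => by positivity
  set b : ℕ → ContDiffBump (0 : EuclideanSpace ℝ (Fin N)) := fun n =>
    ⟨1 / ((n : ℝ) + 1), 2 * (1 / ((n : ℝ) + 1)), hpos n, by linarith [hpos n]⟩ with hb
  refine ⟨fun n => ⟨(b n).normed volume, (b n).contDiff_normed, (b n).hasCompactSupport_normed,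
    fun _ _ => trivial⟩, fun n x => (b n).nonneg_normed x, fun n => (b n).integral_normed,
    fun n x hx => ?_, ?_⟩
  · have : x ∈ Function.support ((b n).normed volume) := hx
    rw [(b n).support_normed_eq, mem_ball_zero_iff] at this
    refine this.le.trans (le_of_eq ?_)
    simp only [hb]
    ring
  · intro f hf
    refine ContDiffBump.ae_convolution_tendsto_right_of_locallyIntegrable (φ := b) (l := atTop)
      (K := 2) ?_ ?_ hf
    · have := (tendsto_one_div_add_atTop_nhds_zero_nat (𝕜 := ℝ)).const_mul 2
      simpa [hb] using this
    · exact Eventually.of_forall fun n => le_rfl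

end Distributions

namespace RISpace

open Filter Topology
open scoped Convolution

variable {N : ℕ} {𝕜 : Type*} [RCLike 𝕜]

local notation "𝔼" => EuclideanSpace ℝ (Fin N)
local notation "𝔻" => TestFunction (⊤ : Opens (EuclideanSpace ℝ (Fin N))) ℝ ⊤

/-- The probability measure with density `φ`. -/
noncomputable def mollifierMeasure (φ : 𝔻) : Measure 𝔼 :=
  volume.withDensity fun x => ((φ x).toNNReal : ℝ≥0∞)

theorem measurable_toNNReal_testFunction (φ : 𝔻) : Measurable fun x => (φ x).toNNReal :=
  φ.continuous.measurable.real_toNNReal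

theorem isProbabilityMeasure_mollifierMeasure {φ : 𝔻} (h0 : ∀ x, 0 ≤ φ x) (h1 : ∫ x, φ x = 1) :
    IsProbabilityMeasure (mollifierMeasure φ) := by
  refine ⟨?_⟩
  rw [mollifierMeasure, withDensity_apply _ MeasurableSet.univ, Measure.restrict_univ]
  have hi : Integrable (φ : 𝔼 → ℝ) volume :=
    φ.continuous.integrable_of_hasCompactSupport φ.hasCompactSupport
  have := ofReal_integral_eq_lintegral_ofReal hi (ae_of_all _ h0)
  rw [h1] at this
  simpa [ENNReal.ofReal] using this.symm

theorem integrable_mollifierMeasure {φ : 𝔻} (h0 : ∀ x, 0 ≤ φ x) {f : 𝔼 → 𝕜}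
    (hf : LocallyIntegrable f volume) (x : 𝔼) :
    Integrable (fun y => f (x - y)) (mollifierMeasure φ) := by
  rw [mollifierMeasure, integrable_withDensity_iff_integrable_smul
    (measurable_toNNReal_testFunction φ)]
  refine (integrable_mollify φ hf x).congr (ae_of_all _ fun y => ?_)
  simp only [NNReal.smul_def, Real.coe_toNNReal _ (h0 y)]

theorem mollify_eq_integral {φ : 𝔻} (h0 : ∀ x, 0 ≤ φ x) (f : 𝔼 → 𝕜) (x : 𝔼) :
    mollify φ f x = ∫ y, f (x - y) ∂(mollifierMeasure φ) := by
  rw [mollifierMeasure, integral_withDensity_eq_integral_smul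
    (measurable_toNNReal_testFunction φ), mollify_apply]
  refine integral_congr_ae (ae_of_all _ fun y => ?_)
  simp only [NNReal.smul_def, Real.coe_toNNReal _ (h0 y)]

theorem aestronglyMeasurable_sub_mollifierMeasure (φ : 𝔻) {f : 𝔼 → 𝕜}
    (hf : AEStronglyMeasurable f volume) :
    AEStronglyMeasurable (Function.uncurry fun y x : 𝔼 => f (x - y))
      ((mollifierMeasure φ).prod volume) := by
  have hq : Measure.QuasiMeasurePreserving (fun z : 𝔼 × 𝔼 => z.2 - z.1)
      ((volume : Measure 𝔼).prod volume) volume :=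
    (quasiMeasurePreserving_sub (volume : Measure 𝔼) volume).comp
      Measure.measurePreserving_swap.quasiMeasurePreserving
  have h1 := hf.comp_quasiMeasurePreserving hq
  refine AEStronglyMeasurable.mono_ac ?_ h1
  exact (withDensity_absolutelyContinuous _ _).prod Measure.AbsolutelyContinuous.rfl

theorem norm_mollify_le (X : RISpace N) {φ : 𝔻} (h0 : ∀ x, 0 ≤ φ x) (h1 : ∫ x, φ x = 1)
    {f : 𝔼 → 𝕜} (hf : LocallyIntegrable f volume) : X.norm (mollify φ f) ≤ X.norm f := by
  have := isProbabilityMeasure_mollifierMeasure h0 h1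
  have hm := hf.aestronglyMeasurable
  rw [funext (mollify_eq_integral h0 f)]
  refine X.norm_integral_le (mollifierMeasure φ) (g := fun y x => f (x - y))
    (aestronglyMeasurable_sub_mollifierMeasure φ hm)
    (ae_of_all _ fun x => integrable_mollifierMeasure h0 hf x) (ae_of_all _ fun y => ?_)
  simp only [sub_eq_add_neg]
  exact (X.norm_translate hm (-y)).le

/-- The error of mollification is controlled by translations by vectors in the support of the
mollifier. -/
theorem norm_sub_mollify_le (X : RISpace N) {φ : 𝔻} (h0 : ∀ x, 0 ≤ φ x) (h1 : ∫ x, φ x = 1)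
    {f : 𝔼 → 𝕜} (hf : LocallyIntegrable f volume) {M : ℝ≥0∞}
    (hM : ∀ y, φ y ≠ 0 → X.norm (fun x => f x - f (x - y)) ≤ M) :
    X.norm (fun x => f x - mollify φ f x) ≤ M := by
  have := isProbabilityMeasure_mollifierMeasure h0 h1
  have hm := hf.aestronglyMeasurable
  have heq : (fun x => f x - mollify φ f x)
      = fun x => ∫ y, (f x - f (x - y)) ∂(mollifierMeasure φ) := by
    funext x
    rw [integral_sub (integrable_const _) (integrable_mollifierMeasure h0 hf x),
      mollify_eq_integral h0]
    simp
  rw [heq]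
  refine X.norm_integral_le (mollifierMeasure φ) (g := fun y x => f x - f (x - y))
    (hm.comp_snd.sub (aestronglyMeasurable_sub_mollifierMeasure φ hm))
    (ae_of_all _ fun x => (integrable_const _).sub (integrable_mollifierMeasure h0 hf x)) ?_
  rw [mollifierMeasure, ae_withDensity_iff (measurable_toNNReal_testFunction φ).coe_nnreal_ennreal]
  refine ae_of_all _ fun y hy => hM y fun h => hy ?_
  simp [h]

end RISpace

/-! ### Identities for differences and the estimate by derivatives -/

section DifferenceIdentities

open Filter Topology

variable {N : ℕ} {𝕜 : Type*} [RCLike 𝕜]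

local notation "𝔼" => EuclideanSpace ℝ (Fin N)

theorem iterDiff_eq_sum_smul (k : ℕ) (h : 𝔼) (f : 𝔼 → 𝕜) (x : 𝔼) :
    iterDiff k h f x
      = ∑ j ∈ Finset.range (k + 1),
          ((-1 : ℝ) ^ (j + k) * (k.choose j : ℝ)) • f (x + (j : ℝ) • h) := by
  unfold iterDiff
  refine Finset.sum_congr rfl fun j _ => ?_
  rw [RCLike.real_smul_eq_coe_mul]
  push_cast
  rfl

theorem iterDiff_eq_diffList (k : ℕ) (h : 𝔼) (f : 𝔼 → 𝕜) :
    iterDiff k h f = diffList (List.replicate k h) f := by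
  have h1 : ∀ n : ℕ, diffList (List.replicate n h) f = (fwdDiff h)^[n] f := by
    intro n
    induction n with
    | zero => rfl
    | succ n ih =>
      rw [List.replicate_succ, diffList_cons, ih, Function.iterate_succ_apply']
      rfl
  funext x
  rw [h1, fwdDiff_iter_eq_sum_shift]
  unfold iterDiff
  refine Finset.sum_congr rfl fun j hj => ?_
  have hjk : j ≤ k := Nat.lt_succ_iff.1 (Finset.mem_range.1 hj)
  have hsign : (-1 : 𝕜) ^ (j + k) = (-1) ^ (k - j) := by
    obtain ⟨m, rfl⟩ := Nat.exists_eq_add_of_le hjk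
    rw [Nat.add_sub_cancel_left, ← add_assoc, pow_add, ← two_mul, pow_mul]
    simp
  rw [hsign, Nat.cast_smul_eq_nsmul, zsmul_eq_mul]
  push_cast
  rfl

/-- The symmetry in `j` and `m` of the points `x + j h + m j s` and `x + m h + m j s` makes this
alternating sum vanish. -/
theorem sum_iterDiff_sub_iterDiff_eq_zero (k : ℕ) (h s : 𝔼) (f : 𝔼 → 𝕜) (x : 𝔼) :
    ∑ j ∈ Finset.range (k + 1), ((-1 : 𝕜) ^ j * (k.choose j : 𝕜)) *
      (iterDiff k ((j : ℝ) • s) f (x + (j : ℝ) • h) - iterDiff k (h + (j : ℝ) • s) f x) = 0 := by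
  simp only [mul_sub, Finset.sum_sub_distrib, iterDiff, Finset.mul_sum]
  rw [sub_eq_zero, Finset.sum_comm]
  refine Finset.sum_congr rfl fun j _ => Finset.sum_congr rfl fun m _ => ?_
  have e : x + (m : ℝ) • h + (j : ℝ) • (m : ℝ) • s = x + (m : ℝ) • (h + (j : ℝ) • s) := by
    rw [smul_add, smul_comm, add_assoc]
  rw [e, pow_add, pow_add]
  ring

/-- The difference with step `h` is a combination of translates of differences whose steps involve
an arbitrary auxiliary vector `s`. -/
theorem iterDiff_eq_sum_auxiliary (k : ℕ) (h s : 𝔼) (f : 𝔼 → 𝕜) (x : 𝔼) (hk : 1 ≤ k) :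
    iterDiff k h f x = ∑ j ∈ Finset.range k, ((-1 : 𝕜) ^ (j + 1) * (k.choose (j + 1) : 𝕜)) *
      (iterDiff k (((j + 1 : ℕ) : ℝ) • s) f (x + ((j + 1 : ℕ) : ℝ) • h)
        - iterDiff k (h + ((j + 1 : ℕ) : ℝ) • s) f x) := by
  have h1 := sum_iterDiff_sub_iterDiff_eq_zero k h s f x
  rw [Finset.sum_range_succ'] at h1
  have h0 : iterDiff k (0 : 𝔼) f x = 0 := by
    rw [iterDiff_eq_diffList]
    obtain ⟨m, rfl⟩ := Nat.exists_eq_add_of_le' hk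
    simp [List.replicate_succ, diffAlong]
  simp only [Nat.cast_zero, zero_smul, add_zero, pow_zero, Nat.choose_zero_right, Nat.cast_one,
    one_mul, h0, zero_sub] at h1
  exact (add_neg_eq_zero.1 h1).symm

/-- Expansion of a mixed difference over the sublists of its list of steps. -/
theorem diffList_map_eq_sum_sublists (L : List (𝔼 × 𝔼)) (m : ℝ) (f : 𝔼 → 𝕜) (x : 𝔼) :
    diffList (L.map fun p => p.1 + m • p.2) f x
      = (L.sublists'.map fun D => (-1 : 𝕜) ^ (L.length + D.length) *
          f (x + (D.map Prod.fst).sum + m • (D.map Prod.snd).sum)).sum := by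
  induction L generalizing x with
  | nil => simp
  | cons p L ih =>
    rw [List.map_cons, diffList_cons, diffAlong, ih, ih, List.sublists'_cons, List.map_append,
      List.sum_append, List.map_map, sub_eq_neg_add]
    congr 1
    · rw [← neg_one_mul, ← List.sum_map_mul_left]
      refine congrArg List.sum (List.map_congr_left fun D _ => ?_)
      rw [List.length_cons, ← mul_assoc]
      congr 1
      ring
    · refine congrArg List.sum (List.map_congr_left fun D _ => ?_)
      simp only [Function.comp_apply, List.length_cons, List.map_cons, List.sum_cons, smul_add]
      congr 1
      · have : L.length + 1 + (D.length + 1) = L.length + D.length + 2 := by ring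
        rw [this, pow_add _ (L.length + D.length) 2, neg_one_sq, mul_one]
      · congr 1
        abel

theorem diffList_eq_zero_of_mem {L : List 𝔼} (h : (0 : 𝔼) ∈ L) (f : 𝔼 → 𝕜) :
    diffList L f = fun _ => 0 := by
  induction L with
  | nil => simp at h
  | cons v L ih =>
    rw [diffList_cons]
    funext x
    rcases List.mem_cons.1 h with h | h
    · simp [diffAlong, ← h]
    · simp [diffAlong, ih h]

/-- A mixed difference of order `k` is a combination of translates of pure differences of
order `k`. With the steps `(1 - m / (i + 1)) v i` in place of `v i`, the mixed difference vanishes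
for `1 ≤ m ≤ k`, so that the alternating sum over `m` leaves only the original mixed difference. -/
theorem diffList_ofFn_eq_sum_iterDiff (k : ℕ) (v : Fin k → 𝔼) (f : 𝔼 → 𝕜) (x : 𝔼) :
    diffList (List.ofFn v) f x
      = ((List.ofFn fun i => (v i, -((i : ℝ) + 1)⁻¹ • v i)).sublists'.map fun D =>
          (-1 : 𝕜) ^ D.length *
            iterDiff k (D.map Prod.snd).sum f (x + (D.map Prod.fst).sum)).sum := by
  set L : List (𝔼 × 𝔼) := List.ofFn fun i => (v i, -((i : ℝ) + 1)⁻¹ • v i) with hL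
  have hlen : L.length = k := by simp [hL]
  have hswap : ∀ (l : List (List (𝔼 × 𝔼))) (F : ℕ → List (𝔼 × 𝔼) → 𝕜),
      (l.map fun D => ∑ m ∈ Finset.range (k + 1), F m D).sum
        = ∑ m ∈ Finset.range (k + 1), (l.map fun D => F m D).sum := by
    intro l F
    induction l with
    | nil => simp
    | cons D l ih => simp [ih, Finset.sum_add_distrib]
  have hterm : ∀ m : ℕ, (L.sublists'.map fun D => (-1 : 𝕜) ^ D.length *
        ((-1 : 𝕜) ^ (m + k) * (k.choose m : 𝕜) *
          f (x + (D.map Prod.fst).sum + (m : ℝ) • (D.map Prod.snd).sum))).sum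
      = (-1 : 𝕜) ^ m * (k.choose m : 𝕜) * diffList (L.map fun p => p.1 + (m : ℝ) • p.2) f x := by
    intro m
    rw [diffList_map_eq_sum_sublists, ← List.sum_map_mul_left]
    refine congrArg List.sum (List.map_congr_left fun D _ => ?_)
    rw [hlen]
    ring
  simp only [iterDiff, Finset.mul_sum]
  rw [hswap]
  simp only [hterm]
  rw [Finset.sum_range_succ', Finset.sum_eq_zero]
  · simp [hL, List.map_ofFn, Function.comp_def]
  · intro m hm
    -- the step with index `m` is `(1 - (m + 1) / (m + 1)) v m = 0`
    have hmem : (0 : 𝔼) ∈ L.map fun p => p.1 + ((m + 1 : ℕ) : ℝ) • p.2 := by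
      rw [hL, List.map_ofFn, List.mem_ofFn]
      refine ⟨⟨m, Finset.mem_range.1 hm⟩, ?_⟩
      have hne : ((m : ℝ) + 1) ≠ 0 := by positivity
      simp only [Function.comp_apply, smul_smul]
      push_cast
      rw [mul_neg, mul_inv_cancel₀ hne]
      simp
    rw [diffList_eq_zero_of_mem hmem]
    simp

end DifferenceIdentities

namespace RISpace

open Filter Topology

variable {N : ℕ} {𝕜 : Type*} [RCLike 𝕜]

local notation "𝔼" => EuclideanSpace ℝ (Fin N)
local notation "𝔻" => TestFunction (⊤ : Opens (EuclideanSpace ℝ (Fin N))) ℝ ⊤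

theorem aestronglyMeasurable_iterDiff (k : ℕ) (h : 𝔼) {f : 𝔼 → 𝕜}
    (hf : AEStronglyMeasurable f volume) : AEStronglyMeasurable (iterDiff k h f) volume := by
  unfold iterDiff
  exact Finset.aestronglyMeasurable_fun_sum _ fun j _ => (hf.comp_translate _).const_mul _

theorem norm_iterDiff_le (X : RISpace N) (k : ℕ) (h : 𝔼) {f : 𝔼 → 𝕜}
    (hf : AEStronglyMeasurable f volume) : X.norm (iterDiff k h f) ≤ 2 ^ k * X.norm f := by
  unfold iterDiff
  refine (X.norm_sum_le _ (f := fun j x => (-1 : 𝕜) ^ (j + k) * (k.choose j : 𝕜) *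
    f (x + (j : ℝ) • h)) fun j _ => (hf.comp_translate _).const_mul _).trans ?_
  have : ∀ j ∈ Finset.range (k + 1), X.norm (fun x => (-1 : 𝕜) ^ (j + k) * (k.choose j : 𝕜) *
      f (x + (j : ℝ) • h)) = (k.choose j : ℝ≥0∞) * X.norm f := by
    intro j _
    rw [X.norm_const_mul _ (hf.comp_translate _), X.norm_translate hf, enorm_mul]
    congr 1
    simp [enorm_eq_nnnorm]
  rw [Finset.sum_congr rfl this, ← Finset.sum_mul, ← Nat.cast_sum, Nat.sum_range_choose]
  simp

theorem norm_list_sum_le (X : RISpace N) {ι : Type*} (l : List ι) (g : ι → 𝔼 → 𝕜) {M : ℝ≥0∞}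
    (hg : ∀ i ∈ l, AEStronglyMeasurable (g i) volume) (hM : ∀ i ∈ l, X.norm (g i) ≤ M) :
    AEStronglyMeasurable (fun x => (l.map fun i => g i x).sum) volume ∧
      X.norm (fun x => (l.map fun i => g i x).sum) ≤ l.length * M := by
  induction l with
  | nil => simpa using ⟨aestronglyMeasurable_const, X.norm_zero⟩
  | cons a l ih =>
    obtain ⟨h1, h2⟩ := ih (fun i hi => hg i (List.mem_cons_of_mem _ hi))
      (fun i hi => hM i (List.mem_cons_of_mem _ hi))
    simp only [List.map_cons, List.sum_cons]
    refine ⟨(hg a List.mem_cons_self).add h1, (X.norm_add_le (hg a List.mem_cons_self) h1).trans ?_⟩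
    rw [List.length_cons, Nat.cast_succ, add_mul, one_mul, add_comm]
    exact add_le_add h2 (hM a List.mem_cons_self)

theorem norm_list_map_sum_le {ι : Type*} (l : List ι) (b : ι → 𝔼) {a : ℝ}
    (h : ∀ i ∈ l, ‖b i‖ ≤ a) : ‖(l.map b).sum‖ ≤ l.length * a := by
  induction l with
  | nil => simp
  | cons i l ih =>
    have h1 := ih fun j hj => h j (List.mem_cons_of_mem _ hj)
    have h2 := h i List.mem_cons_self
    have h3 := _root_.norm_add_le (b i) (l.map b).sum
    rw [List.map_cons, List.sum_cons, List.length_cons]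
    push_cast
    linarith

/-- Mixed differences are controlled by pure differences. -/
theorem norm_diffList_le (X : RISpace N) {k : ℕ} {f : 𝔼 → 𝕜} (hf : AEStronglyMeasurable f volume)
    {L : List 𝔼} (hL : L.length = k) {a : ℝ} (hLa : ∀ v ∈ L, ‖v‖ ≤ a) {M : ℝ≥0∞}
    (hM : ∀ h : 𝔼, ‖h‖ ≤ k * a → X.norm (iterDiff k h f) ≤ M) :
    X.norm (diffList L f) ≤ 2 ^ k * M := by
  subst hL
  have hLv : diffList L f = diffList (List.ofFn L.get) f := by rw [List.ofFn_get]
  rw [hLv, funext (diffList_ofFn_eq_sum_iterDiff L.length L.get f)]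
  set P : List (𝔼 × 𝔼) := List.ofFn fun i => (L.get i, -((i : ℝ) + 1)⁻¹ • L.get i) with hP
  have hPlen : P.length = L.length := by simp [hP]
  refine (X.norm_list_sum_le P.sublists' (fun D x => (-1 : 𝕜) ^ D.length *
    iterDiff L.length (D.map Prod.snd).sum f (x + (D.map Prod.fst).sum)) (M := M) ?_ ?_).2.trans ?_
  · exact fun D _ => ((aestronglyMeasurable_iterDiff _ _ hf).comp_translate _).const_mul _
  · intro D hD
    have hm := aestronglyMeasurable_iterDiff L.length (D.map Prod.snd).sum hf
    rw [X.norm_const_mul _ (hm.comp_translate _), X.norm_translate hm]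
    have hone : ‖(-1 : 𝕜) ^ D.length‖ₑ = 1 := by simp [enorm_eq_nnnorm]
    rw [hone, one_mul]
    apply hM
    have hsub : D.Sublist P := List.mem_sublists'.1 hD
    by_cases hD0 : D = []
    · subst hD0
      rcases L with _ | ⟨v, L⟩
      · simp
      · have := (norm_nonneg v).trans (hLa v List.mem_cons_self)
        simp only [List.map_nil, List.sum_nil, _root_.norm_zero]
        positivity
    have hb : ∀ p ∈ P, ‖p.2‖ ≤ a := by
      intro p hp
      rw [hP, List.mem_ofFn] at hp
      obtain ⟨i, rfl⟩ := hp
      simp only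
      rw [norm_smul]
      have h1 : ‖-((i : ℝ) + 1)⁻¹‖ ≤ 1 := by
        rw [norm_neg, norm_inv, Real.norm_of_nonneg (by positivity)]
        exact inv_le_one_of_one_le₀ (by linarith [(Nat.cast_nonneg (i : ℕ) : (0 : ℝ) ≤ _)])
      have h2 := hLa (L.get i) (List.get_mem L i)
      calc _ ≤ 1 * ‖L.get i‖ := by gcongr
        _ ≤ a := by rw [one_mul]; exact h2
    refine (norm_list_map_sum_le D Prod.snd fun p hp => hb p (hsub.subset hp)).trans ?_
    obtain ⟨p, hp⟩ := List.exists_mem_of_ne_nil D hD0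
    have ha : 0 ≤ a := (norm_nonneg _).trans (hb p (hsub.subset hp))
    have hle : (D.length : ℝ) ≤ L.length := by
      rw [← hPlen]
      exact_mod_cast hsub.length_le
    gcongr
  · rw [List.length_sublists', hPlen]
    simp

theorem norm_intervalIntegral_le (X : RISpace N) {g : ℝ → 𝔼 → 𝕜}
    (hg : Continuous (Function.uncurry g)) {M : ℝ≥0∞}
    (hM : ∀ w ∈ Set.Icc (0 : ℝ) 1, X.norm (g w) ≤ M) :
    X.norm (fun x => ∫ w in (0 : ℝ)..1, g w x) ≤ M := by
  have hp : IsProbabilityMeasure (volume.restrict (Set.Ioc (0 : ℝ) 1)) :=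
    ⟨by simp⟩
  simp only [intervalIntegral.integral_of_le zero_le_one]
  refine X.norm_integral_le (volume.restrict (Set.Ioc (0 : ℝ) 1)) hg.aestronglyMeasurable ?_ ?_
  · refine ae_of_all _ fun x => ?_
    have hc : Continuous fun w => g w x := hg.comp (by fun_prop : Continuous fun w : ℝ => (w, x))
    exact hc.integrableOn_Ioc
  · exact (ae_restrict_mem measurableSet_Ioc).mono fun w hw => hM w ⟨hw.1.le, hw.2⟩

theorem norm_aveAlong_le (X : RISpace N) (v : 𝔼) {Q : 𝔼 → 𝕜} (hQ : Continuous Q) :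
    X.norm (aveAlong v Q) ≤ X.norm Q := by
  refine X.norm_intervalIntegral_le (g := fun w x => Q (x + w • v)) ?_ fun w _ => ?_
  · unfold Function.uncurry
    fun_prop
  · exact (X.norm_translate hQ.aestronglyMeasurable _).le

theorem norm_aveList_le (X : RISpace N) (L : List 𝔼) {Q : 𝔼 → 𝕜} (hQ : Continuous Q) :
    X.norm (aveList L Q) ≤ X.norm Q := by
  induction L with
  | nil => exact le_rfl
  | cons v L ih => exact (X.norm_aveAlong_le v (continuous_aveList L hQ)).trans ih

/-- Iterated means of a family `y ↦ H (y, ·)` in the parameter `y`. -/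
theorem norm_aveList_param_le (X : RISpace N) (L : List 𝔼) {H : 𝔼 × 𝔼 → 𝕜} (hH : Continuous H)
    {a r : ℝ} (hLa : ∀ v ∈ L, ‖v‖ ≤ a) {M : ℝ≥0∞}
    (hM : ∀ y : 𝔼, ‖y‖ ≤ r → X.norm (fun x => H (y, x)) ≤ M) (y : 𝔼)
    (hy : ‖y‖ + L.length * a ≤ r) :
    X.norm (fun x => aveList (L.map fun v => (v, (0 : 𝔼))) H (y, x)) ≤ M := by
  induction L generalizing y with
  | nil => exact hM y (by simpa using hy)
  | cons v L ih =>
    rw [List.map_cons, aveList_cons]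
    have hc := continuous_aveList (L.map fun v => (v, (0 : 𝔼))) hH
    refine X.norm_intervalIntegral_le (g := fun w x =>
      aveList (L.map fun v => (v, (0 : 𝔼))) H ((y, x) + w • (v, (0 : 𝔼)))) ?_ fun w hw => ?_
    · unfold Function.uncurry
      fun_prop
    · have : ∀ x : 𝔼, (y, x) + w • (v, (0 : 𝔼)) = (y + w • v, x) := fun x => by simp
      simp only [this]
      refine ih (fun u hu => hLa u (List.mem_cons_of_mem _ hu)) _ ?_
      have h1 : ‖w • v‖ ≤ a := by
        rw [norm_smul, Real.norm_of_nonneg hw.1]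
        have := hLa v List.mem_cons_self
        nlinarith [norm_nonneg v, hw.2]
      have h2 := _root_.norm_add_le y (w • v)
      rw [List.length_cons] at hy
      push_cast at hy
      linarith

theorem norm_dirDerivList_replicate_le (X : RISpace N) (h : 𝔼) (k : ℕ) {M : ℝ≥0∞} :
    ∀ {F : 𝔼 → 𝕜}, Smooth F →
      (∀ w : List (Fin N), w.length = k → X.norm (dirDerivList (w.map basisVec) F) ≤ M) →
      X.norm (dirDerivList (List.replicate k h) F) ≤ (N * ‖h‖ₑ) ^ k * M := by
  induction k generalizing M with
  | zero =>
    intro F _ hM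
    simpa using hM [] rfl
  | succ k ih =>
    intro F hF hM
    have hexp : dirDeriv h F = fun x => ∑ i, h i • dirDeriv (basisVec i) F x := by
      funext x
      have : h = ∑ i, h i • (basisVec i : 𝔼) := by
        ext j
        simp [basisVec, Finset.sum_apply, Pi.single_apply]
      conv_lhs => rw [this]
      simp [dirDeriv]
    rw [List.replicate_succ', dirDerivList_append, dirDerivList_cons, dirDerivList_nil,
      pow_succ, mul_assoc]
    refine ih (hF.dirDeriv h) fun w hw => ?_
    rw [hexp, dirDerivList_sum_smul _ _ _ fun i _ => hF.dirDeriv _]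
    have hs : ∀ i, Smooth (dirDerivList (w.map basisVec) (dirDeriv (basisVec i) F)) := fun i =>
      (hF.dirDeriv _).dirDerivList _
    refine (X.norm_sum_le _ (f := fun i x => h i •
      dirDerivList (w.map basisVec) (dirDeriv (basisVec i) F) x)
      fun i _ => (hs i).continuous.aestronglyMeasurable.const_smul _).trans ?_
    have hterm : ∀ i, X.norm (fun x => h i •
        dirDerivList (w.map basisVec) (dirDeriv (basisVec i) F) x) ≤ ‖h‖ₑ * M := by
      intro i
      rw [X.norm_real_smul _ (hs i).continuous.aestronglyMeasurable]
      gcongr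
      · exact enorm_le_iff_norm_le.2 (PiLp.norm_apply_le h i)
      · have := hM (w ++ [i]) (by simp [hw])
        rwa [List.map_append, dirDerivList_append] at this
    refine (Finset.sum_le_sum fun i _ => hterm i).trans ?_
    simp [mul_assoc]

theorem distNorm_regularDistribution (X : RISpace N) {g : 𝔼 → 𝕜} (hg : X.Mem g) :
    X.distNorm (regularDistribution g) = X.norm g := by
  refine le_antisymm (iInf₂_le g ⟨hg, rfl⟩) (le_iInf₂ fun g' hg' => ?_)
  exact (X.norm_congr hg.1 (ae_eq_of_regularDistribution_eq hg.locallyIntegrable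
    hg'.1.locallyIntegrable hg'.2.symm)).le

/-- Differences of order `k` are controlled by the derivatives of order `k`. The inequality passes
from the mollifications of `f` to `f` by the Fatou property. -/
theorem norm_iterDiff_le_homSobolevNorm (X : RISpace N) (k : ℕ) {f : 𝔼 → 𝕜}
    (hf : LocallyIntegrable f volume) (hX : X.MemHomSobolev k (regularDistribution f)) (h : 𝔼) :
    X.norm (iterDiff k h f)
      ≤ (N * ‖h‖ₑ) ^ k * X.homSobolevNorm k (regularDistribution f) := by
  obtain ⟨φ, h0, h1, -, hlim⟩ := exists_mollifiers N 𝕜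
  refine X.norm_le_of_tendsto (g := fun n => iterDiff k h (mollify (φ n) f)) (fun n => ?_) ?_
    fun n => ?_
  · exact aestronglyMeasurable_iterDiff k h
      (smooth_mollify (φ n) hf).continuous.aestronglyMeasurable
  · have hj : ∀ᵐ x ∂(volume : Measure 𝔼), ∀ j : ℕ, Tendsto
        (fun n => mollify (φ n) f (x + (j : ℝ) • h)) atTop (𝓝 (f (x + (j : ℝ) • h))) :=
      ae_all_iff.2 fun j => (measurePreserving_add_right volume
        ((j : ℝ) • h)).quasiMeasurePreserving.ae (hlim f hf)
    filter_upwards [hj] with x hx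
    unfold iterDiff
    exact tendsto_finsetSum _ fun j _ => (hx j).const_mul _
  · have hs := smooth_mollify (φ n) hf
    rw [iterDiff_eq_diffList, diffList_eq_aveList_dirDerivList _ hs]
    refine (X.norm_aveList_le _ (hs.dirDerivList _).continuous).trans
      (X.norm_dirDerivList_replicate_le h k hs fun w hw => ?_)
    obtain ⟨α, hα, hp⟩ := exists_perm_multiWord w
    obtain ⟨g, hg, hgα⟩ := hX α (hα.trans hw)
    rw [multiDeriv_eq_distDerivList] at hgα
    rw [dirDerivList_perm (hp.map basisVec) hs,
      dirDerivList_mollify (φ n) hf hg.locallyIntegrable hgα.symm]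
    refine (X.norm_mollify_le (h0 n) (h1 n) hg.locallyIntegrable).trans ?_
    rw [← X.distNorm_regularDistribution hg, hgα, ← multiDeriv_eq_distDerivList]
    exact Finset.single_le_sum (f := fun α => X.distNorm (multiDeriv α (regularDistribution f)))
      (fun _ _ => zero_le) (Finset.mem_piAntidiag.2 ⟨hα.trans hw, fun i _ => Finset.mem_univ i⟩)

end RISpace

/-! ### From the mean of the modulus to its supremum, and the lower bound -/

section AverageToSup

open Filter Topology

variable {N : ℕ}

local notation "𝔼" => EuclideanSpace ℝ (Fin N)

theorem volume_closedBall_eq {t : ℝ} (ht : 0 ≤ t) :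
    volume (Metric.closedBall (0 : 𝔼) t)
      = ENNReal.ofReal (t ^ N) * volume (Metric.closedBall (0 : 𝔼) 1) := by
  have := Measure.addHaar_closedBall' (volume : Measure 𝔼) 0 ht
  rwa [finrank_euclideanSpace_fin] at this

/-- Markov's inequality shows that `ω` is bounded by a multiple of its mean outside a set of small
measure, and the subadditivity relation, with a step `s` that avoids this set, transfers the bound
to all `h` in the smaller ball. This works for every exponent `p > 0`. -/
theorem exists_le_mean_of_subadditive (N k : ℕ) (hk : 1 ≤ k) (p : ℝ) (hp : 0 < p) :
    ∃ C : ℝ≥0∞, C ≠ ∞ ∧ C ≠ 0 ∧ ∀ ω : EuclideanSpace ℝ (Fin N) → ℝ≥0∞, Measurable ω →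
      (∀ h s, ω h ≤ ∑ j ∈ Finset.range k, (k.choose (j + 1) : ℝ≥0∞) *
        (ω (((j + 1 : ℕ) : ℝ) • s) + ω (h + ((j + 1 : ℕ) : ℝ) • s))) →
      ∀ t : ℝ, 0 < t → ∀ h : EuclideanSpace ℝ (Fin N), ‖h‖ ≤ t / 2 →
        ω h ≤ C * ((ENNReal.ofReal (t ^ N))⁻¹ *
          ∫⁻ h in Metric.closedBall (0 : EuclideanSpace ℝ (Fin N)) t, ω h ^ p) ^ (1 / p) := by
  have hk0 : (0 : ℝ) < k := by exact_mod_cast hk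
  set V : ℝ≥0∞ := volume (Metric.closedBall (0 : EuclideanSpace ℝ (Fin N)) 1) with hV
  have hV0 : V ≠ 0 := (Metric.measure_closedBall_pos _ _ one_pos).ne'
  have hVt : V ≠ ∞ := measure_closedBall_lt_top.ne
  -- the measure of the ball of radius `t / (2k)`, divided by `t ^ N`
  set W : ℝ≥0∞ := ENNReal.ofReal ((1 / (2 * k)) ^ N) * V with hW
  have hW0 : W ≠ 0 :=
    mul_ne_zero (by simp only [ne_eq, ENNReal.ofReal_eq_zero, not_le]; positivity) hV0
  have hWt : W ≠ ∞ := ENNReal.mul_ne_top ENNReal.ofReal_ne_top hVt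
  -- the exceptional set occupies at most the proportion `η` of `t ^ N`
  set η : ℝ≥0∞ := W / (2 * k + 1) with hη
  have hd : (2 * k + 1 : ℝ≥0∞) ≠ ∞ := by simp [ENNReal.mul_eq_top]
  have hη0 : η ≠ 0 := ENNReal.div_ne_zero.2 ⟨hW0, hd⟩
  have hηt : η ≠ ∞ := ENNReal.div_ne_top hWt (by simp)
  have hηW : (2 * k) * η < W := by
    have : (2 * k + 1) * η = W := ENNReal.mul_div_cancel (by simp) hd
    rw [← this, add_mul, one_mul]
    exact ENNReal.lt_add_right (ENNReal.mul_ne_top (by simp [ENNReal.mul_eq_top]) hηt) hη0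
  have h2k : (2 : ℝ≥0∞) ^ (k + 1) ≠ 0 := by simp
  have h2kt : (2 : ℝ≥0∞) ^ (k + 1) ≠ ∞ := by simp
  -- `2 ^ (k + 1)` bounds the sum of the coefficients in the subadditivity relation
  refine ⟨2 ^ (k + 1) * (η⁻¹) ^ (1 / p), ENNReal.mul_ne_top h2kt
    (ENNReal.rpow_ne_top_of_nonneg (by positivity) (ENNReal.inv_ne_top.2 hη0)),
    mul_ne_zero h2k ?_, ?_⟩
  · rw [ne_eq, ENNReal.rpow_eq_zero_iff]
    rintro (⟨h, -⟩ | ⟨h, -⟩)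
    · exact hηt (ENNReal.inv_eq_zero.1 h)
    · exact hη0 (ENNReal.inv_eq_top.1 h)
  intro ω hω hsub t ht h hh
  set T : ℝ≥0∞ := ENNReal.ofReal (t ^ N) with hT
  have hT0 : T ≠ 0 := by
    simp only [hT, ne_eq, ENNReal.ofReal_eq_zero, not_le]
    positivity
  have hTt : T ≠ ∞ := ENNReal.ofReal_ne_top
  set I : ℝ≥0∞ := ∫⁻ h in Metric.closedBall (0 : EuclideanSpace ℝ (Fin N)) t, ω h ^ p with hI
  -- a level `a` above the claimed bound is positive even when the mean vanishes
  refine le_of_forall_gt_imp_ge_of_dense fun a ha => ?_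
  rcases eq_or_ne a ∞ with rfl | hat
  · exact le_top
  set l : ℝ≥0∞ := a / 2 ^ (k + 1) with hl
  have hlt : l ≠ ∞ := ENNReal.div_ne_top hat h2k
  have hla : 2 ^ (k + 1) * l = a := ENNReal.mul_div_cancel h2k h2kt
  have hgt : (η⁻¹) ^ (1 / p) * (T⁻¹ * I) ^ (1 / p) < l := by
    rw [← hla, mul_assoc] at ha
    exact lt_of_mul_lt_mul_left' ha
  have hl0 : l ≠ 0 := (zero_le.trans_lt hgt).ne'
  have hIl : I ≤ η * T * l ^ p := by
    rw [← ENNReal.mul_rpow_of_nonneg _ _ (by positivity)] at hgt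
    have h1 : η⁻¹ * (T⁻¹ * I) ≤ l ^ p := by
      have := ENNReal.rpow_le_rpow hgt.le hp.le
      rwa [← ENNReal.rpow_mul, one_div, inv_mul_cancel₀ hp.ne', ENNReal.rpow_one] at this
    calc I = (η * η⁻¹) * (T * T⁻¹) * I := by
          rw [ENNReal.mul_inv_cancel hη0 hηt, ENNReal.mul_inv_cancel hT0 hTt, one_mul, one_mul]
      _ = η * T * (η⁻¹ * (T⁻¹ * I)) := by ring
      _ ≤ η * T * l ^ p := by gcongr
  have hlp0 : l ^ p ≠ 0 := by
    rw [ne_eq, ENNReal.rpow_eq_zero_iff]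
    rintro (⟨h, -⟩ | ⟨h, -⟩)
    · exact hl0 h
    · exact hlt h
  have hlpt : l ^ p ≠ ∞ := ENNReal.rpow_ne_top_of_nonneg hp.le hlt
  set B : Set (EuclideanSpace ℝ (Fin N)) := {y | l < ω y} ∩ Metric.closedBall 0 t with hB
  have hBvol : volume B ≤ η * T := by
    have h1 : l ^ p * volume B ≤ I := by
      have h2 := mul_meas_ge_le_lintegral (μ := volume.restrict
        (Metric.closedBall (0 : EuclideanSpace ℝ (Fin N)) t)) (hω.pow_const p) (l ^ p)
      refine le_trans (mul_le_mul' le_rfl ?_) h2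
      rw [Measure.restrict_apply (measurableSet_le measurable_const (hω.pow_const p))]
      refine measure_mono fun y hy => ⟨?_, hy.2⟩
      exact ENNReal.rpow_le_rpow (le_of_lt hy.1) hp.le
    have h3 : l ^ p * volume B ≤ l ^ p * (η * T) := (h1.trans hIl).trans (by rw [mul_comm])
    exact (ENNReal.mul_le_mul_iff_right hlp0 hlpt).1 h3
  -- the steps `s` for which one of the points `j s`, `h + j s` is exceptional
  set Bad : Set (EuclideanSpace ℝ (Fin N)) := ⋃ j ∈ Finset.range k,
    ((fun s => ((j + 1 : ℕ) : ℝ) • s) ⁻¹' B ∪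
      (fun s => ((j + 1 : ℕ) : ℝ) • s) ⁻¹' ((fun y => h + y) ⁻¹' B)) with hBad
  have hpre : ∀ (j : ℕ) (S : Set (EuclideanSpace ℝ (Fin N))),
      volume ((fun s => ((j + 1 : ℕ) : ℝ) • s) ⁻¹' S) ≤ volume S := by
    intro j S
    have hj : ((j + 1 : ℕ) : ℝ) ≠ 0 := by positivity
    rw [Measure.addHaar_preimage_smul _ hj]
    refine mul_le_of_le_one_left' ?_
    rw [ENNReal.ofReal_le_one, abs_of_nonneg (by positivity)]
    refine inv_le_one_of_one_le₀ (one_le_pow₀ ?_)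
    push_cast
    linarith [(Nat.cast_nonneg j : (0 : ℝ) ≤ j)]
  have hBadvol : volume Bad < volume (Metric.closedBall (0 : EuclideanSpace ℝ (Fin N))
      (t * (1 / (2 * k)))) := by
    calc volume Bad ≤ ∑ j ∈ Finset.range k, (η * T + η * T) := by
          refine (measure_biUnion_finset_le _ _).trans (Finset.sum_le_sum fun j _ => ?_)
          refine (measure_union_le _ _).trans (add_le_add ((hpre _ _).trans hBvol) ?_)
          refine (hpre _ _).trans ?_
          rwa [measure_preimage_add]
      _ = (2 * k) * η * T := by
          rw [Finset.sum_const, Finset.card_range, nsmul_eq_mul]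
          ring
      _ < W * T := ENNReal.mul_lt_mul_left hT0 hTt hηW
      _ = _ := by
          rw [volume_closedBall_eq (by positivity), mul_pow, ENNReal.ofReal_mul (by positivity)]
          ring
  obtain ⟨s, hs, hsB⟩ : ∃ s ∈ Metric.closedBall (0 : EuclideanSpace ℝ (Fin N))
      (t * (1 / (2 * k))), s ∉ Bad := by
    by_contra! hcon
    exact absurd (measure_mono hcon) (not_le.2 hBadvol)
  rw [mem_closedBall_zero_iff] at hs
  have hgood : ∀ j ∈ Finset.range k, ω (((j + 1 : ℕ) : ℝ) • s) ≤ l ∧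
      ω (h + ((j + 1 : ℕ) : ℝ) • s) ≤ l := by
    intro j hj
    have hjk : ((j + 1 : ℕ) : ℝ) ≤ k := by exact_mod_cast Finset.mem_range.1 hj
    have hnorm : ‖((j + 1 : ℕ) : ℝ) • s‖ ≤ t / 2 := by
      rw [norm_smul, Real.norm_of_nonneg (by positivity)]
      calc ((j + 1 : ℕ) : ℝ) * ‖s‖ ≤ k * (t * (1 / (2 * k))) := by gcongr
        _ = t / 2 := by field_simp
    have hnot : s ∉ ((fun s => ((j + 1 : ℕ) : ℝ) • s) ⁻¹' B ∪
        (fun s => ((j + 1 : ℕ) : ℝ) • s) ⁻¹' ((fun y => h + y) ⁻¹' B)) := fun hmem =>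
      hsB (Set.mem_biUnion hj hmem)
    rw [Set.mem_union, not_or] at hnot
    refine ⟨?_, ?_⟩ <;> by_contra! hcon
    · exact hnot.1 ⟨hcon, mem_closedBall_zero_iff.2 (by linarith)⟩
    · refine hnot.2 ⟨hcon, mem_closedBall_zero_iff.2 ?_⟩
      have := norm_add_le h (((j + 1 : ℕ) : ℝ) • s)
      linarith
  refine (hsub h s).trans ?_
  calc ∑ j ∈ Finset.range k, (k.choose (j + 1) : ℝ≥0∞) *
        (ω (((j + 1 : ℕ) : ℝ) • s) + ω (h + ((j + 1 : ℕ) : ℝ) • s))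
      ≤ ∑ j ∈ Finset.range k, (k.choose (j + 1) : ℝ≥0∞) * (l + l) := by
        refine Finset.sum_le_sum fun j hj => ?_
        have := hgood j hj
        gcongr
        exacts [this.1, this.2]
    _ = ((∑ j ∈ Finset.range k, k.choose (j + 1) : ℕ) : ℝ≥0∞) * (l + l) := by
        rw [← Finset.sum_mul, Nat.cast_sum]
    _ ≤ ((2 ^ k : ℕ) : ℝ≥0∞) * (l + l) := by
        gcongr
        rw [← Nat.sum_range_choose, Finset.sum_range_succ']
        exact Nat.le_add_right _ _
    _ = a := by
        rw [← hla]
        push_cast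
        ring

end AverageToSup

namespace RISpace

open Filter Topology

variable {N : ℕ} {𝕜 : Type*} [RCLike 𝕜]

local notation "𝔼" => EuclideanSpace ℝ (Fin N)

theorem multiDeriv_zero (F : Distribution (⊤ : Opens 𝔼) 𝕜 ⊤) :
    multiDeriv (0 : Fin N → ℕ) F = F := by
  rw [multiDeriv_eq_distDerivList]
  have : multiWord (0 : Fin N → ℕ) = [] := List.length_eq_zero_iff.1 (by simp [length_multiWord])
  rw [this]
  rfl

theorem MemSobolev.mem {X : RISpace N} {k : ℕ} {f : 𝔼 → 𝕜} (hf : X.MemSobolev k f) : X.Mem f := by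
  obtain ⟨g, hg, hgf⟩ := hf.2 0 (by simp)
  rw [multiDeriv_zero] at hgf
  have h := ae_eq_of_regularDistribution_eq hg.locallyIntegrable hf.1 hgf
  exact ⟨hf.1.aestronglyMeasurable, by rw [← X.norm_congr hg.1 h]; exact hg.2⟩

theorem homSobolevNorm_lt_top {X : RISpace N} {k : ℕ} {F : Distribution (⊤ : Opens 𝔼) 𝕜 ⊤}
    (hF : X.MemHomSobolev k F) : X.homSobolevNorm k F < ∞ := by
  refine ENNReal.sum_lt_top.2 fun α hα => ?_
  obtain ⟨g, hg, hgα⟩ := hF α (Finset.mem_piAntidiag.1 hα).1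
  rw [← hgα, X.distNorm_regularDistribution hg]
  exact hg.2

/-- Functions with first derivatives in `X` are Lipschitz continuous under translation. -/
theorem MemSobolev.exists_norm_translate_sub_le {X : RISpace N} {k : ℕ} (hk : 1 ≤ k) {f : 𝔼 → 𝕜}
    (hf : X.MemSobolev k f) : ∃ C : ℝ≥0∞, C ≠ ∞ ∧
      ∀ h : 𝔼, X.norm (fun x => f (x + h) - f x) ≤ C * ‖h‖ₑ := by
  have h1 : X.MemHomSobolev 1 (regularDistribution f) := fun α hα => hf.2 α (hα.le.trans hk)
  refine ⟨N * X.homSobolevNorm 1 (regularDistribution f),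
    ENNReal.mul_ne_top (by simp) (homSobolevNorm_lt_top h1).ne, fun h => ?_⟩
  have h2 := X.norm_iterDiff_le_homSobolevNorm 1 hf.1 h1 h
  have h3 : iterDiff 1 h f = fun x => f (x + h) - f x := by
    rw [iterDiff_eq_diffList]
    rfl
  rw [h3, pow_one] at h2
  exact h2.trans (le_of_eq (by ring))

theorem MemSobolev.continuous_norm_iterDiff {X : RISpace N} {k : ℕ} (hk : 1 ≤ k) {f : 𝔼 → 𝕜}
    (hf : X.MemSobolev k f) : Continuous fun h : 𝔼 => X.norm (iterDiff k h f) := by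
  obtain ⟨C, hC, hCf⟩ := hf.exists_norm_translate_sub_le hk
  have hm := hf.mem.1
  refine continuous_of_le_add_edist (∑ j ∈ Finset.range (k + 1), (k.choose j : ℝ≥0∞) * (C * j))
    (ENNReal.sum_ne_top.2 fun j _ => ENNReal.mul_ne_top (by simp) (ENNReal.mul_ne_top hC (by simp)))
    fun h h' => ?_
  have hdiff : iterDiff k h f = fun x => iterDiff k h' f x +
      ∑ j ∈ Finset.range (k + 1), (-1 : 𝕜) ^ (j + k) * (k.choose j : 𝕜) *
        (f (x + (j : ℝ) • h) - f (x + (j : ℝ) • h')) := by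
    funext x
    simp only [iterDiff, mul_sub, Finset.sum_sub_distrib]
    ring
  have hmj : ∀ j : ℕ, AEStronglyMeasurable
      (fun x => f (x + (j : ℝ) • h) - f (x + (j : ℝ) • h')) volume := fun j =>
    (hm.comp_translate _).sub (hm.comp_translate _)
  have hm1 := aestronglyMeasurable_iterDiff k h' hm
  rw [hdiff]
  refine (X.norm_add_le hm1 (Finset.aestronglyMeasurable_fun_sum _
    fun j _ => (hmj j).const_mul _)).trans (add_le_add le_rfl ?_)
  refine (X.norm_sum_le _ (f := fun j x => (-1 : 𝕜) ^ (j + k) * (k.choose j : 𝕜) *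
    (f (x + (j : ℝ) • h) - f (x + (j : ℝ) • h'))) fun j _ => (hmj j).const_mul _).trans ?_
  rw [Finset.sum_mul]
  refine Finset.sum_le_sum fun j _ => ?_
  rw [X.norm_const_mul _ (hmj j), enorm_mul]
  have h1 : ‖(-1 : 𝕜) ^ (j + k)‖ₑ * ‖(k.choose j : 𝕜)‖ₑ = k.choose j := by
    simp [enorm_eq_nnnorm]
  rw [h1, mul_assoc]
  gcongr
  have h2 : (fun x => f (x + (j : ℝ) • h) - f (x + (j : ℝ) • h'))
      = fun x => (fun z => f (z + (j : ℝ) • (h - h')) - f z) (x + (j : ℝ) • h') := by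
    funext x
    have : x + (j : ℝ) • h' + (j : ℝ) • (h - h') = x + (j : ℝ) • h := by
      rw [smul_sub]
      abel
    simp only [this]
  rw [h2, X.norm_translate (f := fun z => f (z + (j : ℝ) • (h - h')) - f z)
    ((hm.comp_translate _).sub hm)]
  refine (hCf _).trans (le_of_eq ?_)
  rw [enorm_smul, edist_eq_enorm_sub, mul_assoc]
  congr 2
  simp

theorem norm_iterDiff_subadditive (X : RISpace N) {k : ℕ} (hk : 1 ≤ k) {f : 𝔼 → 𝕜}
    (hm : AEStronglyMeasurable f volume) (h s : 𝔼) :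
    X.norm (iterDiff k h f) ≤ ∑ j ∈ Finset.range k, (k.choose (j + 1) : ℝ≥0∞) *
      (X.norm (iterDiff k (((j + 1 : ℕ) : ℝ) • s) f)
        + X.norm (iterDiff k (h + ((j + 1 : ℕ) : ℝ) • s) f)) := by
  rw [funext fun x => iterDiff_eq_sum_auxiliary k h s f x hk]
  have h1 : ∀ j : ℕ, AEStronglyMeasurable
      (fun x => iterDiff k (((j + 1 : ℕ) : ℝ) • s) f (x + ((j + 1 : ℕ) : ℝ) • h)) volume := fun j =>
    (aestronglyMeasurable_iterDiff k _ hm).comp_translate _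
  have h2 : ∀ j : ℕ, AEStronglyMeasurable (iterDiff k (h + ((j + 1 : ℕ) : ℝ) • s) f) volume :=
    fun j => aestronglyMeasurable_iterDiff k _ hm
  refine (X.norm_sum_le _ (f := fun j x => ((-1 : 𝕜) ^ (j + 1) * (k.choose (j + 1) : 𝕜)) *
      (iterDiff k (((j + 1 : ℕ) : ℝ) • s) f (x + ((j + 1 : ℕ) : ℝ) • h)
        - iterDiff k (h + ((j + 1 : ℕ) : ℝ) • s) f x))
    fun j _ => ((h1 j).sub (h2 j)).const_mul _).trans ?_
  refine Finset.sum_le_sum fun j _ => ?_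
  have h12 : AEStronglyMeasurable
      (fun x => iterDiff k (((j + 1 : ℕ) : ℝ) • s) f (x + ((j + 1 : ℕ) : ℝ) • h)
        - iterDiff k (h + ((j + 1 : ℕ) : ℝ) • s) f x) volume := (h1 j).sub (h2 j)
  rw [X.norm_const_mul _ h12, enorm_mul]
  have h3 : ‖(-1 : 𝕜) ^ (j + 1)‖ₑ * ‖(k.choose (j + 1) : 𝕜)‖ₑ = k.choose (j + 1) := by
    simp [enorm_eq_nnnorm]
  rw [h3]
  gcongr
  refine (X.norm_sub_le (h1 j) (h2 j)).trans (add_le_add (le_of_eq ?_) le_rfl)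
  exact X.norm_translate (aestronglyMeasurable_iterDiff k _ hm) _

/-- The mean of the modulus of smoothness is bounded by its supremum. -/
theorem avgModulus_le (X : RISpace N) (k : ℕ) {p t : ℝ} (hp : 0 < p) (ht : 0 < t) {f : 𝔼 → 𝕜}
    {M : ℝ≥0∞} (hM : ∀ h : 𝔼, ‖h‖ ≤ t → X.norm (iterDiff k h f) ≤ M) :
    X.avgModulus k p t f ≤ volume (Metric.closedBall (0 : 𝔼) 1) ^ (1 / p) * M := by
  have hT0 : ENNReal.ofReal (t ^ N) ≠ 0 := by
    simp only [ne_eq, ENNReal.ofReal_eq_zero, not_le]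
    positivity
  have hI : ∫⁻ h in Metric.closedBall (0 : 𝔼) t, X.norm (iterDiff k h f) ^ p
      ≤ M ^ p * (ENNReal.ofReal (t ^ N) * volume (Metric.closedBall (0 : 𝔼) 1)) := by
    rw [← volume_closedBall_eq ht.le]
    refine (setLIntegral_mono' (g := fun _ => M ^ p) measurableSet_closedBall
      fun h hh => ?_).trans (by rw [setLIntegral_const])
    exact ENNReal.rpow_le_rpow (hM h (mem_closedBall_zero_iff.1 hh)) hp.le
  calc X.avgModulus k p t f ≤ ((ENNReal.ofReal (t ^ N))⁻¹ *
        (M ^ p * (ENNReal.ofReal (t ^ N) * volume (Metric.closedBall (0 : 𝔼) 1)))) ^ (1 / p) :=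
        ENNReal.rpow_le_rpow (by gcongr) (by positivity)
    _ = (volume (Metric.closedBall (0 : 𝔼) 1) * M ^ p) ^ (1 / p) := by
        congr 1
        rw [mul_comm (M ^ p), mul_assoc, ← mul_assoc, ENNReal.inv_mul_cancel hT0
          ENNReal.ofReal_ne_top, one_mul]
    _ = _ := by
        rw [ENNReal.mul_rpow_of_nonneg _ _ (by positivity), ← ENNReal.rpow_mul, one_div,
          mul_inv_cancel₀ hp.ne', ENNReal.rpow_one]

/-- Every admissible decomposition of `f` bounds the differences of `f`. -/
theorem norm_iterDiff_le_of_decomposition (X : RISpace N) (k : ℕ) {f f₀ : 𝔼 → 𝕜} (hf : X.Mem f)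
    {F₁ : Distribution (⊤ : Opens 𝔼) 𝕜 ⊤} (hf₀ : X.Mem f₀) (hF₁ : X.MemHomSobolev k F₁)
    (hdec : regularDistribution f = regularDistribution f₀ + F₁) {t : ℝ} {h : 𝔼} (hh : ‖h‖ ≤ t) :
    X.norm (iterDiff k h f) ≤ (2 ^ k + (N : ℝ≥0∞) ^ k) *
      (X.norm f₀ + ENNReal.ofReal (t ^ k) * X.homSobolevNorm k F₁) := by
  have ht : 0 ≤ t := (norm_nonneg h).trans hh
  have hl := hf.locallyIntegrable
  have hl₀ := hf₀.locallyIntegrable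
  have hl₁ : LocallyIntegrable (fun x => f x - f₀ x) volume := hl.sub hl₀
  have hreg : F₁ = regularDistribution fun x => f x - f₀ x := by
    have h1 := regularDistribution_add hl₀ hl₁
    simp only [add_sub_cancel] at h1
    have h2 : regularDistribution f
        = regularDistribution f₀ + regularDistribution fun x => f x - f₀ x := h1
    exact add_left_cancel (hdec.symm.trans h2)
  have hsplit : iterDiff k h f
      = fun x => iterDiff k h f₀ x + iterDiff k h (fun x => f x - f₀ x) x := by
    funext x
    simp only [iterDiff, ← Finset.sum_add_distrib, ← mul_add, add_sub_cancel]
  rw [hsplit]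
  refine (X.norm_add_le (aestronglyMeasurable_iterDiff k h hf₀.1)
    (aestronglyMeasurable_iterDiff k h hl₁.aestronglyMeasurable)).trans ?_
  have h3 := X.norm_iterDiff_le k h hf₀.1
  rw [hreg] at hF₁ ⊢
  have h4 := X.norm_iterDiff_le_homSobolevNorm k hl₁ hF₁ h
  have h5 : (N * ‖h‖ₑ) ^ k ≤ (N : ℝ≥0∞) ^ k * ENNReal.ofReal (t ^ k) := by
    rw [mul_pow, ENNReal.ofReal_pow ht]
    gcongr
    rw [← ofReal_norm]
    exact ENNReal.ofReal_le_ofReal hh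
  calc _ ≤ 2 ^ k * X.norm f₀ + (N : ℝ≥0∞) ^ k * (ENNReal.ofReal (t ^ k) *
        X.homSobolevNorm k (regularDistribution fun x => f x - f₀ x)) := by
        refine add_le_add h3 (h4.trans ?_)
        rw [← mul_assoc]
        gcongr
    _ ≤ _ := by
        rw [mul_add]
        gcongr
        · exact le_self_add
        · exact le_add_self

end RISpace

/-! ### Approximation by Steklov means and the upper bound -/

namespace RISpace

open Filter Topology

variable {N : ℕ} {𝕜 : Type*} [RCLike 𝕜]

local notation "𝔼" => EuclideanSpace ℝ (Fin N)
local notation "𝔻" => TestFunction (⊤ : Opens (EuclideanSpace ℝ (Fin N))) ℝ ⊤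

theorem locallyIntegrable_translate {f : 𝔼 → 𝕜} (hf : LocallyIntegrable f volume) (h : 𝔼) :
    LocallyIntegrable (fun x => f (x + h)) volume := by
  intro x
  obtain ⟨s, hs, hfs⟩ := hf (x + h)
  refine ⟨(fun z => z + h) ⁻¹' s, (continuous_add_const h).continuousAt hs, ?_⟩
  exact ((measurePreserving_add_right volume h).integrableOn_comp_preimage
    (measurableEmbedding_addRight h)).2 hfs

theorem locallyIntegrable_iterDiff (k : ℕ) (h : 𝔼) {f : 𝔼 → 𝕜}
    (hf : LocallyIntegrable f volume) : LocallyIntegrable (iterDiff k h f) volume := by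
  rw [funext (iterDiff_eq_sum_smul k h f)]
  exact locallyIntegrable_finsetSum _ fun j _ =>
    (locallyIntegrable_translate hf ((j : ℝ) • h)).smul ((-1 : ℝ) ^ (j + k) * (k.choose j : ℝ))

theorem iterDiff_mollify (k : ℕ) (h : 𝔼) (φ : 𝔻) {f : 𝔼 → 𝕜}
    (hf : LocallyIntegrable f volume) :
    iterDiff k h (mollify φ f) = mollify φ (iterDiff k h f) := by
  funext x
  have hj : ∀ j : ℕ, Integrable (fun y => φ y • f (x + (j : ℝ) • h - y)) volume := fun j =>
    integrable_mollify φ hf _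
  simp only [iterDiff, mollify_apply, Finset.smul_sum]
  rw [integral_finsetSum]
  · refine Finset.sum_congr rfl fun j _ => ?_
    rw [← integral_const_mul]
    refine integral_congr_ae (ae_of_all _ fun y => ?_)
    simp only
    rw [mul_smul_comm, sub_add_eq_add_sub]
  · intro j _
    refine ((hj j).const_mul ((-1 : 𝕜) ^ (j + k) * (k.choose j : 𝕜))).congr
      (ae_of_all _ fun y => ?_)
    simp only
    rw [mul_smul_comm, sub_add_eq_add_sub]

/-- Means over the full word in which every coordinate occurs `k` times turn a derivative of order
`k` into a mixed difference of order `k`. -/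
theorem norm_aveList_dirDerivList_le (X : RISpace N) {k : ℕ} {F : 𝔼 → 𝕜} (hF : Smooth F)
    {α : Fin N → ℕ} (hα : ∑ i, α i = k) {b : ℝ} (hb : 0 < b) {M : ℝ≥0∞}
    (hM : ∀ h : 𝔼, ‖h‖ ≤ k * b → X.norm (iterDiff k h F) ≤ M) :
    X.norm (aveList ((multiWord fun _ : Fin N => k).map fun i => b • (basisVec i : 𝔼))
        (dirDerivList ((multiWord α).map basisVec) F))
      ≤ ENNReal.ofReal (b ^ k)⁻¹ * (2 ^ k * M) := by
  have hsub : (multiWord α).Subperm (multiWord fun _ : Fin N => k) := by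
    rw [List.subperm_ext_iff]
    intro i _
    rw [count_multiWord, count_multiWord, ← hα]
    exact Finset.single_le_sum (fun _ _ => Nat.zero_le _) (Finset.mem_univ i)
  obtain ⟨R, hR⟩ : ∃ R, (multiWord fun _ : Fin N => k).Perm (R ++ multiWord α) := by
    obtain ⟨l, hl, hls⟩ := hsub
    obtain ⟨R, hR⟩ := hls.exists_perm_append
    exact ⟨R, hR.trans ((hl.append_right R).trans List.perm_append_comm)⟩
  set L : List 𝔼 := (multiWord α).map basisVec with hL
  have hLlen : L.length = k := by rw [hL, List.length_map, length_multiWord, hα]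
  have hD := hF.dirDerivList L
  have hLb : (multiWord α).map (fun i => b • (basisVec i : 𝔼)) = L.map (b • ·) := by
    rw [hL, List.map_map]
    rfl
  have hscale : dirDerivList L F = fun y => (b ^ k)⁻¹ • dirDerivList (L.map (b • ·)) F y := by
    rw [dirDerivList_map_smul b L hF, hLlen]
    funext y
    rw [smul_smul, inv_mul_cancel₀ (by positivity), one_smul]
  have hD' := hF.dirDerivList (L.map (b • ·))
  have hsmul : ∀ (K : List 𝔼) (c : ℝ) {Q : 𝔼 → 𝕜}, Continuous Q →
      aveList K (fun y => c • Q y) = fun y => c • aveList K Q y := by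
    intro K c Q hQ
    simpa using aveList_sum_smul (Finset.univ : Finset Unit) K (fun _ => c) (Q := fun _ => Q)
      fun _ _ => hQ
  rw [aveList_perm (hR.map _) hD.continuous, List.map_append,
    aveList_append, hLb, hscale,
    hsmul _ _ hD'.continuous, ← diffList_eq_aveList_dirDerivList _ hF]
  have hc : Continuous (diffList (L.map (b • ·)) F) := by
    rw [diffList_eq_aveList_dirDerivList _ hF]
    exact continuous_aveList _ hD'.continuous
  have hc' : Continuous fun y => (b ^ k)⁻¹ • diffList (L.map (b • ·)) F y := hc.const_smul _
  refine (X.norm_aveList_le _ hc').trans ?_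
  rw [X.norm_real_smul _ hc.aestronglyMeasurable, Real.enorm_of_nonneg (by positivity)]
  gcongr
  refine X.norm_diffList_le hF.continuous.aestronglyMeasurable (by simpa using hLlen) (a := b) ?_ hM
  intro v hv
  obtain ⟨u, hu, rfl⟩ := List.mem_map.1 hv
  obtain ⟨i, -, rfl⟩ := List.mem_map.1 hu
  simp [norm_smul, abs_of_pos hb]

/-- A smooth function is approximated, with error bounded by its differences of order `k` with
steps of length at most `r`, by a smooth function with derivatives of order `k` bounded by the same
quantity times a power of `r`. The approximation is the combination of iterated means at the
scales `a`, `2a`, …, `ka` for which the error is a mean of differences of order `k`. -/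
theorem exists_smooth_approximation (X : RISpace N) {k : ℕ} (hk : 1 ≤ k) {F : 𝔼 → 𝕜}
    (hF : Smooth F) {r : ℝ} (hr : 0 < r) {M : ℝ≥0∞}
    (hM : ∀ h : 𝔼, ‖h‖ ≤ r → X.norm (iterDiff k h F) ≤ M) :
    ∃ F₁ : 𝔼 → 𝕜, Smooth F₁ ∧ X.norm (fun x => F x - F₁ x) ≤ M ∧
      ∀ α : Fin N → ℕ, ∑ i, α i = k →
        X.norm (dirDerivList ((multiWord α).map basisVec) F₁)
          ≤ ENNReal.ofReal ((r / (k * (N + k))) ^ k)⁻¹ * (4 ^ k * M) := by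
  have hk0 : (1 : ℝ) ≤ k := by exact_mod_cast hk
  have hN0 : (0 : ℝ) ≤ N := Nat.cast_nonneg N
  -- `N * k * a ≤ r` bounds the steps of the pure differences that are averaged in the error, and
  -- `k * (k * a) ≤ r` those of the pure differences that make up the mixed ones
  set a : ℝ := r / (k * (N + k)) with ha
  have ha0 : 0 < a := by positivity
  have har : a * (k * (N + k)) = r := by
    rw [ha]
    field_simp
  set W : List (Fin N) := multiWord fun _ : Fin N => k with hW
  have hWlen : (W.length : ℝ) = N * k := by
    rw [hW, length_multiWord]
    simp
  set A : ℝ → (𝔼 → 𝕜) → 𝔼 → 𝕜 := fun b Q =>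
    aveList (W.map fun i => b • (basisVec i : 𝔼)) Q with hA
  have hAs : ∀ b {Q : 𝔼 → 𝕜}, Smooth Q → Smooth (A b Q) := fun b Q hQ => hQ.aveList _
  set F₁ : 𝔼 → 𝕜 := fun x => ∑ j ∈ Finset.range k,
    ((-1 : ℝ) ^ j * (k.choose (j + 1) : ℝ)) • A (((j + 1 : ℕ) : ℝ) * a) F x with hF₁
  refine ⟨F₁, Smooth.sum_smul _ _ fun j _ => hAs _ hF, ?_, fun α hα => ?_⟩
  · -- the error is the iterated mean of `iterDiff k y F x` in the variable `y`
    set H : 𝔼 × 𝔼 → 𝕜 := fun z => ∑ j ∈ Finset.range (k + 1),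
      ((-1 : ℝ) ^ (j + k) * (k.choose j : ℝ)) • F (z.2 + (j : ℝ) • z.1) with hH
    have hFc := hF.continuous
    have hHc : Continuous H := by
      rw [hH]
      fun_prop
    have hHnorm := X.norm_aveList_param_le (W.map fun i => a • (basisVec i : 𝔼)) hHc
      (a := a) (r := r) (M := M) ?_ ?_ 0 ?_
    · have hterm : ∀ (j : ℕ) (x : 𝔼), aveList ((W.map fun i => a • (basisVec i : 𝔼)).map
          fun v => (v, (0 : 𝔼))) (fun z : 𝔼 × 𝔼 => F (z.2 + (j : ℝ) • z.1)) (0, x)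
            = A ((j : ℝ) * a) F x := by
        intro j x
        have h1 := aveList_comp_clm (ContinuousLinearMap.snd ℝ 𝔼 𝔼
          + (j : ℝ) • ContinuousLinearMap.fst ℝ 𝔼 𝔼)
          ((W.map fun i => a • (basisVec i : 𝔼)).map fun v => (v, (0 : 𝔼))) F
        have h2 := congrFun h1 (0, x)
        simp only [add_apply, ContinuousLinearMap.coe_snd', smul_apply,
          ContinuousLinearMap.coe_fst', smul_zero, add_zero] at h2
        rw [h2, hA, List.map_map, List.map_map]
        congr 2
        funext i
        simp [smul_smul]
      have hzero : A 0 F = F := by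
        have : ∀ l : List (Fin N), aveList (l.map fun i => (0 : ℝ) • (basisVec i : 𝔼)) F = F := by
          intro l
          induction l with
          | nil => rfl
          | cons i l ih =>
            rw [List.map_cons, aveList_cons, ih]
            funext y
            simp [aveAlong]
        exact this W
      have heq : ∀ x : 𝔼, F x - F₁ x = (-1 : 𝕜) ^ k *
          aveList ((W.map fun i => a • (basisVec i : 𝔼)).map fun v => (v, (0 : 𝔼))) H (0, x) := by
        intro x
        rw [hH, aveList_sum_smul _ _ _ fun j _ => by fun_prop]
        simp only [hterm]
        rw [Finset.sum_range_succ', mul_add, Finset.mul_sum]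
        have hsq : (-1 : 𝕜) ^ k * (-1) ^ k = 1 := by rw [← mul_pow]; simp
        simp only [RCLike.real_smul_eq_coe_mul, Nat.cast_zero, zero_mul, hzero, zero_add,
          Nat.choose_zero_right, Nat.cast_one, mul_one, hF₁]
        push_cast
        rw [← mul_assoc, hsq, one_mul, add_comm, sub_eq_add_neg, ← Finset.sum_neg_distrib]
        congr 1
        refine Finset.sum_congr rfl fun j _ => ?_
        rw [← mul_assoc, ← mul_assoc, pow_add, pow_succ]
        linear_combination (norm := ring_nf) (((-1 : 𝕜) ^ j * (k.choose (j + 1) : 𝕜)) *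
          A (((j : ℝ) + 1) * a) F x) * hsq
      rw [funext heq, X.norm_const_mul]
      · have hone : ‖(-1 : 𝕜) ^ k‖ₑ = 1 := by simp [enorm_eq_nnnorm]
        rw [hone, one_mul]
        exact hHnorm
      · exact ((continuous_aveList _ hHc).comp
          (by fun_prop : Continuous fun x : 𝔼 => ((0 : 𝔼), x))).aestronglyMeasurable
    · intro v hv
      obtain ⟨i, -, rfl⟩ := List.mem_map.1 hv
      simp [norm_smul, abs_of_pos ha0]
    · intro y hy
      have := hM y hy
      rwa [funext (iterDiff_eq_sum_smul k y F)] at this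
    · rw [_root_.norm_zero, zero_add, List.length_map, hWlen, ← har]
      nlinarith [mul_pos ha0 (by linarith : (0 : ℝ) < k)]
  · set L : List 𝔼 := (multiWord α).map basisVec with hL
    have hder : dirDerivList L F₁ = fun x => ∑ j ∈ Finset.range k,
        ((-1 : ℝ) ^ j * (k.choose (j + 1) : ℝ)) •
          A (((j + 1 : ℕ) : ℝ) * a) (dirDerivList L F) x := by
      rw [hF₁, dirDerivList_sum_smul _ _ _ fun j _ => hAs _ hF]
      funext x
      simp only [hA, dirDerivList_aveList _ _ hF]
    have hAm : ∀ b, AEStronglyMeasurable (A b (dirDerivList L F)) volume := fun b =>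
      (hAs b (hF.dirDerivList L)).continuous.aestronglyMeasurable
    rw [hder]
    refine (X.norm_sum_le _ (f := fun j x => ((-1 : ℝ) ^ j * (k.choose (j + 1) : ℝ)) •
      A (((j + 1 : ℕ) : ℝ) * a) (dirDerivList L F) x) fun j _ => (hAm _).const_smul _).trans ?_
    have hterm : ∀ j ∈ Finset.range k, X.norm (fun x => ((-1 : ℝ) ^ j * (k.choose (j + 1) : ℝ)) •
        A (((j + 1 : ℕ) : ℝ) * a) (dirDerivList L F) x)
          ≤ (k.choose (j + 1) : ℝ≥0∞) * (ENNReal.ofReal (a ^ k)⁻¹ * (2 ^ k * M)) := by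
      intro j hj
      have hjk : ((j + 1 : ℕ) : ℝ) ≤ k := by exact_mod_cast Finset.mem_range.1 hj
      have hj1 : (1 : ℝ) ≤ ((j + 1 : ℕ) : ℝ) := by
        push_cast
        linarith [(Nat.cast_nonneg j : (0 : ℝ) ≤ j)]
      have hba : a ≤ ((j + 1 : ℕ) : ℝ) * a := le_mul_of_one_le_left ha0.le hj1
      rw [X.norm_real_smul _ (hAm _), enorm_mul]
      have h3 : ‖(-1 : ℝ) ^ j‖ₑ * ‖(k.choose (j + 1) : ℝ)‖ₑ = k.choose (j + 1) := by
        simp [enorm_eq_nnnorm]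
      rw [h3]
      gcongr
      refine (X.norm_aveList_dirDerivList_le hF hα (by positivity) fun h hh => hM h
        (hh.trans ?_)).trans ?_
      · have hN1 : 0 ≤ a * N * k := by positivity
        calc (k : ℝ) * (((j + 1 : ℕ) : ℝ) * a) ≤ k * (k * a) := by gcongr
          _ ≤ a * (k * (N + k)) := by nlinarith
          _ = r := har
      · gcongr
    refine (Finset.sum_le_sum hterm).trans ?_
    rw [← Finset.sum_mul, ← Nat.cast_sum]
    calc ((∑ j ∈ Finset.range k, k.choose (j + 1) : ℕ) : ℝ≥0∞) *
          (ENNReal.ofReal (a ^ k)⁻¹ * (2 ^ k * M))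
        ≤ ((2 ^ k : ℕ) : ℝ≥0∞) * (ENNReal.ofReal (a ^ k)⁻¹ * (2 ^ k * M)) := by
          gcongr
          rw [← Nat.sum_range_choose, Finset.sum_range_succ']
          exact Nat.le_add_right _ _
      _ = ENNReal.ofReal (a ^ k)⁻¹ * (4 ^ k * M) := by
          have : (4 : ℝ≥0∞) ^ k = 2 ^ k * 2 ^ k := by
            rw [← mul_pow]
            norm_num
          rw [this]
          push_cast
          ring

/-- The `K`-functional is controlled by the differences with steps of length at most `t / 2`. The
decomposition is that of a mollification of `f`, and the error of mollification tends to zero. -/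
theorem kFunctional_le (X : RISpace N) {k : ℕ} (hk : 1 ≤ k) {f : 𝔼 → 𝕜} (hf : X.MemSobolev k f)
    {t : ℝ} (ht : 0 < t) {M : ℝ≥0∞} (hMt : M ≠ ∞)
    (hM : ∀ h : 𝔼, ‖h‖ ≤ t / 2 → X.norm (iterDiff k h f) ≤ M) :
    X.kFunctional k (t ^ k) (regularDistribution f)
      ≤ (1 + (Finset.piAntidiag (Finset.univ : Finset (Fin N)) k).card *
          (ENNReal.ofReal ((2 * (k * (N + k))) ^ k) * 4 ^ k)) * M := by
  have hfX := hf.mem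
  have hk0 : (1 : ℝ) ≤ k := by exact_mod_cast hk
  obtain ⟨C, hC, hCf⟩ := hf.exists_norm_translate_sub_le hk
  obtain ⟨φ, h0, h1, hsupp, -⟩ := exists_mollifiers N 𝕜
  set Q : ℝ≥0∞ := (1 + (Finset.piAntidiag (Finset.univ : Finset (Fin N)) k).card *
    (ENNReal.ofReal ((2 * (k * (N + k))) ^ k) * 4 ^ k)) * M with hQ
  have key : ∀ n : ℕ, X.kFunctional k (t ^ k) (regularDistribution f)
      ≤ C * ENNReal.ofReal (2 / ((n : ℝ) + 1)) + Q := by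
    intro n
    set F : 𝔼 → 𝕜 := mollify (φ n) f with hFdef
    have hF : Smooth F := smooth_mollify (φ n) hf.1
    have hFm : AEStronglyMeasurable F volume := hF.continuous.aestronglyMeasurable
    obtain ⟨F₁, hF₁, hF₁M, hF₁D⟩ := X.exists_smooth_approximation hk hF (half_pos ht) (M := M) (by
      intro h hh
      rw [hFdef, iterDiff_mollify k h (φ n) hf.1]
      exact (X.norm_mollify_le (h0 n) (h1 n) (locallyIntegrable_iterDiff k h hf.1)).trans (hM h hh))
    have hF₁m : AEStronglyMeasurable F₁ volume := hF₁.continuous.aestronglyMeasurable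
    have hfF : X.norm (fun x => f x - F x) ≤ C * ENNReal.ofReal (2 / ((n : ℝ) + 1)) := by
      refine X.norm_sub_mollify_le (h0 n) (h1 n) hf.1 fun y hy => ?_
      have h2 : (fun x => f x - f (x - y)) = fun x => (fun z => f (z + y) - f z) (x + -y) := by
        funext x
        simp [sub_eq_add_neg]
      rw [h2, X.norm_translate (f := fun z => f (z + y) - f z)
        ((hfX.1.comp_translate y).sub hfX.1)]
      refine (hCf y).trans ?_
      gcongr
      rw [← ofReal_norm]
      exact ENNReal.ofReal_le_ofReal (hsupp n y hy)
    have hnorm₀ : X.norm (fun x => f x - F₁ x) ≤ C * ENNReal.ofReal (2 / ((n : ℝ) + 1)) + M := by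
      have h2 : (fun x => f x - F₁ x) = fun x => (f x - F x) + (F x - F₁ x) := by
        funext x
        ring
      rw [h2]
      exact (X.norm_add_le (hfX.1.sub hFm) (hFm.sub hF₁m)).trans (add_le_add hfF hF₁M)
    have hmem₀ : X.Mem fun x => f x - F₁ x :=
      ⟨hfX.1.sub hF₁m, hnorm₀.trans_lt (ENNReal.add_lt_top.2
        ⟨ENNReal.mul_lt_top hC.lt_top ENNReal.ofReal_lt_top, hMt.lt_top⟩)⟩
    have hmul : ∀ α : Fin N → ℕ, multiDeriv α (regularDistribution F₁)
        = regularDistribution (dirDerivList ((multiWord α).map basisVec) F₁) := fun α => by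
      rw [multiDeriv_eq_distDerivList, distDerivList_regularDistribution hF₁]
    have hmemD : ∀ α : Fin N → ℕ, ∑ i, α i = k →
        X.Mem (dirDerivList ((multiWord α).map basisVec) F₁) := fun α hα =>
      ⟨(hF₁.dirDerivList _).continuous.aestronglyMeasurable, (hF₁D α hα).trans_lt
        (ENNReal.mul_lt_top ENNReal.ofReal_lt_top
          (ENNReal.mul_lt_top (by simp) hMt.lt_top))⟩
    have hmem₁ : X.MemHomSobolev k (regularDistribution F₁) := fun α hα =>
      ⟨_, hmemD α hα, (hmul α).symm⟩
    have hdec : regularDistribution f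
        = regularDistribution (fun x => f x - F₁ x) + regularDistribution F₁ := by
      rw [← regularDistribution_add hmem₀.locallyIntegrable hF₁.continuous.locallyIntegrable]
      simp only [sub_add_cancel]
    have hhom : X.homSobolevNorm k (regularDistribution F₁)
        ≤ (Finset.piAntidiag (Finset.univ : Finset (Fin N)) k).card *
          (ENNReal.ofReal ((t / 2 / (k * (N + k))) ^ k)⁻¹ * (4 ^ k * M)) := by
      unfold homSobolevNorm
      refine (Finset.sum_le_card_nsmul _ _ _ fun α hα => ?_).trans (by rw [nsmul_eq_mul])
      have hα' := (Finset.mem_piAntidiag.1 hα).1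
      rw [hmul α, X.distNorm_regularDistribution (hmemD α hα')]
      exact hF₁D α hα'
    have hscale : ENNReal.ofReal (t ^ k) * ENNReal.ofReal ((t / 2 / (k * (N + k))) ^ k)⁻¹
        = ENNReal.ofReal ((2 * (k * (N + k))) ^ k) := by
      rw [← ENNReal.ofReal_mul (by positivity), ← inv_pow, ← mul_pow]
      congr 2
      field_simp
    calc X.kFunctional k (t ^ k) (regularDistribution f)
        ≤ X.norm (fun x => f x - F₁ x)
          + ENNReal.ofReal (t ^ k) * X.homSobolevNorm k (regularDistribution F₁) :=
          iInf_le_of_le _ (iInf_le_of_le _ (iInf_le_of_le ⟨hmem₀, hmem₁, hdec⟩ le_rfl))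
      _ ≤ (C * ENNReal.ofReal (2 / ((n : ℝ) + 1)) + M) + ENNReal.ofReal (t ^ k) *
          ((Finset.piAntidiag (Finset.univ : Finset (Fin N)) k).card *
          (ENNReal.ofReal ((t / 2 / (k * (N + k))) ^ k)⁻¹ * (4 ^ k * M))) := by gcongr
      _ = C * ENNReal.ofReal (2 / ((n : ℝ) + 1)) + Q := by
          rw [hQ, ← hscale]
          ring
  have hlim : Tendsto (fun n : ℕ => C * ENNReal.ofReal (2 / ((n : ℝ) + 1)) + Q) atTop (𝓝 Q) := by
    have h2 : Tendsto (fun n : ℕ => (2 : ℝ) / ((n : ℝ) + 1)) atTop (𝓝 0) := by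
      simpa [div_eq_mul_inv] using
        (tendsto_one_div_add_atTop_nhds_zero_nat (𝕜 := ℝ)).const_mul 2
    have h3 := ENNReal.Tendsto.const_mul (ENNReal.tendsto_ofReal h2) (Or.inr hC)
    simpa using h3.add_const Q
  exact ge_of_tendsto' hlim key

end RISpace

theorem mainTheorem12 {𝕜 : Type*} [RCLike 𝕜] (N k : ℕ) (hN : 1 ≤ N) (hk : 1 ≤ k)
    (p : ℝ) (hp : 0 < p) :
    ∃ c C : ℝ, 0 < c ∧ 0 < C ∧
      ∀ (X : RISpace N) (f : EuclideanSpace ℝ (Fin N) → 𝕜), X.MemSobolev k f →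
        ∀ t : ℝ, 0 < t →
          ENNReal.ofReal c * X.avgModulus k p t f
              ≤ X.kFunctional k (t ^ k) (regularDistribution f) ∧
            X.kFunctional k (t ^ k) (regularDistribution f)
              ≤ ENNReal.ofReal C * X.avgModulus k p t f := by
  obtain ⟨C₁, hC₁t, hC₁0, hC₁⟩ := exists_le_mean_of_subadditive N k hk p hp
  set V : ℝ≥0∞ := volume (Metric.closedBall (0 : EuclideanSpace ℝ (Fin N)) 1) ^ (1 / p) with hV
  have hVt : V ≠ ∞ := ENNReal.rpow_ne_top_of_nonneg (by positivity) measure_closedBall_lt_top.ne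
  set P : ℝ≥0∞ := V * (2 ^ k + (N : ℝ≥0∞) ^ k) with hP
  have hPt : P ≠ ∞ := ENNReal.mul_ne_top hVt (by simp)
  set Q : ℝ≥0∞ := (1 + (Finset.piAntidiag (Finset.univ : Finset (Fin N)) k).card *
    (ENNReal.ofReal ((2 * (k * (N + k))) ^ k) * 4 ^ k)) * C₁ with hQ
  have hQt : Q ≠ ∞ := by
    refine ENNReal.mul_ne_top (ENNReal.add_ne_top.2 ⟨by simp, ENNReal.mul_ne_top (by simp)
      (ENNReal.mul_ne_top ENNReal.ofReal_ne_top (by simp))⟩) hC₁t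
  -- adding `1` makes the constants positive without a discussion of `P` and `Q`
  refine ⟨(P.toReal + 1)⁻¹, Q.toReal + 1, by positivity, by positivity, fun X f hf t ht => ⟨?_, ?_⟩⟩
  · refine le_iInf fun f₀ => le_iInf fun F₁ => le_iInf fun ⟨hf₀, hF₁, hdec⟩ => ?_
    have h1 := X.avgModulus_le k hp ht fun h hh =>
      X.norm_iterDiff_le_of_decomposition k hf.mem hf₀ hF₁ hdec hh
    rw [← mul_assoc, ← hV, ← hP] at h1
    refine (mul_le_mul' le_rfl h1).trans ?_
    rw [← mul_assoc]
    refine mul_le_of_le_one_left' ?_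
    rw [← ENNReal.ofReal_toReal hPt, ← ENNReal.ofReal_mul (by positivity), ENNReal.ofReal_le_one,
      ENNReal.toReal_ofReal ENNReal.toReal_nonneg, inv_mul_le_one₀ (by positivity)]
    linarith
  · rcases eq_or_ne (X.avgModulus k p t f) ∞ with hA | hA
    · rw [hA, ENNReal.mul_top]
      · exact le_top
      · simp only [ne_eq, ENNReal.ofReal_eq_zero, not_le]
        positivity
    have hω := hC₁ _ (hf.continuous_norm_iterDiff hk).measurable
      (X.norm_iterDiff_subadditive hk hf.mem.1) t ht
    refine (X.kFunctional_le hk hf ht (ENNReal.mul_ne_top hC₁t hA) hω).trans ?_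
    rw [← mul_assoc, ← hQ]
    gcongr
    rw [ENNReal.le_ofReal_iff_toReal_le hQt (by positivity)]
    linarith
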